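/- Let $M_n = M_n(\mathbb{C})$. An operator system (quantum graph) in $M_n$ is a complex linear subspace $\mathcal V \subseteq M_n$ with $I_n \in \mathcal V$ and $A^* \in \mathcal V$ for all $A \in \mathcal V$. For a positive integer $j$, a $j$-clique of $\mathcal V$ is an orthogonal projection $P \in M_n$ of rank $j$ such that $P\mathcal V P = P M_n P$; a $j$-anticlique of $\mathcal V$ is an orthogonal projection $P \in M_n$ of rank $j$ such that $P \mathcal V P = \mathrm{span}\{P\}$. For positive integers $j$ and $k$, the quantum Ramsey number $QR(j,k)$ is the least positive integer $N$ such that, for all $n \geq N$, every operator system $\mathcal V \subseteq M_n$ has a $j$-clique or a $k$-anticlique. Theorem. For every positive integer $k$, $QR(2,k) = 3k-2$. That is, for every $n \geq 3k-2$, every operator system $\mathcal V \subseteq M_n$ has a $2$-clique or a $k$-anticlique, whereas there is an operator system in $M_{3k-3}$ that has neither a $2$-clique nor a $k$-anticlique (for $k=1$ this last assertion is the trivial one about $M_0 = \{0\}$). In particular, $QR(2,2) = 4$. -/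

import Mathlib

/-- A quantum graph on `M_n(ℂ)`, i.e. an operator system in `M_n(ℂ)`: a complex linear subspace
that contains the identity matrix and is closed under conjugate transposition. -/
structure IsOperatorSystem {n : ℕ} (V : Submodule ℂ (Matrix (Fin n) (Fin n) ℂ)) : Prop where
  one_mem : (1 : Matrix (Fin n) (Fin n) ℂ) ∈ V
  conjTranspose_mem : ∀ A ∈ V, A.conjTranspose ∈ V

/-- The compression `P V P = {P A P | A ∈ V}`. -/
def compression {n : ℕ} (P : Matrix (Fin n) (Fin n) ℂ)
    (V : Submodule ℂ (Matrix (Fin n) (Fin n) ℂ)) : Submodule ℂ (Matrix (Fin n) (Fin n) ℂ) :=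
  V.map (LinearMap.mulLeftRight ℂ (P, P))

theorem mem_compression {n : ℕ} {P : Matrix (Fin n) (Fin n) ℂ}
    {V : Submodule ℂ (Matrix (Fin n) (Fin n) ℂ)} {B : Matrix (Fin n) (Fin n) ℂ} :
    B ∈ compression P V ↔ ∃ A ∈ V, P * A * P = B := by
  simp [compression]

/-- `V` has a `j`-clique: an orthogonal projection `P` (self-adjoint idempotent) of rank `j` with
`P V P = P M_n P`. -/
def HasClique {n : ℕ} (V : Submodule ℂ (Matrix (Fin n) (Fin n) ℂ)) (j : ℕ) : Prop :=
  ∃ P : Matrix (Fin n) (Fin n) ℂ, IsStarProjection P ∧ P.rank = j ∧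
    compression P V = compression P ⊤

/-- `V` has a `k`-anticlique: an orthogonal projection `P` (self-adjoint idempotent) of rank `k`
with `P V P = span {P}`. -/
def HasAnticlique {n : ℕ} (V : Submodule ℂ (Matrix (Fin n) (Fin n) ℂ)) (k : ℕ) : Prop :=
  ∃ P : Matrix (Fin n) (Fin n) ℂ, IsStarProjection P ∧ P.rank = k ∧
    compression P V = Submodule.span ℂ {P}

/-- Every operator system in `M_n(ℂ)` has a `j`-clique or a `k`-anticlique. -/
def QuantumRamseyProperty (j k n : ℕ) : Prop :=
  ∀ V : Submodule ℂ (Matrix (Fin n) (Fin n) ℂ), IsOperatorSystem V →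
    HasClique V j ∨ HasAnticlique V k

/-- The quantum Ramsey number: the least positive integer `N` such that for all `n ≥ N` every
operator system in `M_n(ℂ)` has a `j`-clique or a `k`-anticlique.
If there were no such `N`, this would be `0`, so a positive value says that the minimum exists. -/
noncomputable def quantumRamseyNumber (j k : ℕ) : ℕ :=
  sInf {N : ℕ | 0 < N ∧ ∀ n : ℕ, N ≤ n → QuantumRamseyProperty j k n}

/-! The dichotomy is governed by the dimension of the operator system `V`: dimension at least four
forces a 2-clique, and dimension at most three forces a `k`-anticlique once `n ≥ 3k - 2`.

In dimension at most three, `V` lies in the span of `1` and two Hermitian matrices `A`, `B`, so an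
anticlique is a `k`-dimensional subspace on which both quadratic forms are scalar: the rank-`k`
numerical range of `A + iB` must be nonempty. Helly's theorem in the plane provides scalars `s`, `t`
such that every real combination of `A - s` and `B - t` is nonnegative on some `k`-dimensional
subspace (`exists_forall_hasNonneg_shiftOp`). Such a pair of forms has a common isotropic subspace
of dimension `k` (`hasIsotropic_of_forall_hasNonneg`). This goes by induction on `k`: it is enough
to find one common isotropic vector `x` at which the two forms are linearly dependent, for then `x`
splits off (`hasIsotropic_succ_of_dependent`). If some nonzero combination is not strictly positive
in dimension `k`, its radical contains such an `x`. Otherwise the problem is reduced to a subspace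
of dimension at most `2k`, where either strictness fails or an eigenvector of the nondegenerate
pencil serves as `x`.

In dimension at least four, take a two-column frame `U` that maximizes the rank of `X ↦ Uᴴ X U` on
`V`. If the image is proper, some nonzero Hermitian `X` in `V` is compressed to zero. Maximality
gives first and second order conditions at `U`, and tested against a Hermitian matrix annihilating
the image they force `X = 0` (`hasClique_two_of_four_le_finrank`).

For sharpness, three diagonal projections of rank `k - 1` with sum `1` span a system of dimension
too small for a 2-clique, and their ranks are too small for a `k`-anticlique. -/

open Module

/-! ### Hermitian forms on subspaces: positivity, limits and Sylvester splitting -/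

section HermitianForms

variable {E : Type*} [NormedAddCommGroup E] [InnerProductSpace ℂ E]

/-- The real quadratic form `x ↦ re ⟪H x, x⟫` of an operator. -/
noncomputable def quadForm (H : E →L[ℂ] E) (x : E) : ℝ := (inner ℂ (H x) x).re

/-- The symmetric bilinear condition for a continuous operator. -/
abbrev IsHermitianOp (H : E →L[ℂ] E) : Prop := ∀ x y : E, inner ℂ (H x) y = inner ℂ x (H y)

/-- The real linear combination `a A + b B`. -/
noncomputable def realComb (A B : E →L[ℂ] E) (a b : ℝ) : E →L[ℂ] E := (a : ℂ) • A + (b : ℂ) • B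

theorem IsHermitianOp.realComb {A B : E →L[ℂ] E} (hA : IsHermitianOp A) (hB : IsHermitianOp B)
    (a b : ℝ) : IsHermitianOp (realComb A B a b) := by
  intro x y
  simp [_root_.realComb, hA x y, hB x y]

theorem quadForm_realComb (A B : E →L[ℂ] E) (a b : ℝ) (x : E) :
    quadForm (realComb A B a b) x = a * quadForm A x + b * quadForm B x := by
  simp [quadForm, realComb]

theorem inner_realComb (A B : E →L[ℂ] E) (a b : ℝ) (x y : E) :
    inner ℂ (realComb A B a b x) y = a * inner ℂ (A x) y + b * inner ℂ (B x) y := by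
  simp [realComb]

theorem quadForm_id (x : E) : quadForm (ContinuousLinearMap.id ℂ E) x = ‖x‖ ^ 2 := by
  have := inner_self_eq_norm_sq (𝕜 := ℂ) x
  simpa [quadForm] using this

theorem quadForm_zero (H : E →L[ℂ] E) : quadForm H 0 = 0 := by simp [quadForm]

theorem quadForm_neg (H : E →L[ℂ] E) (x : E) : quadForm (-H) x = -quadForm H x := by
  simp [quadForm]

theorem quadForm_smul (H : E →L[ℂ] E) (c : ℂ) (x : E) :
    quadForm H (c • x) = ‖c‖ ^ 2 * quadForm H x := by
  simp only [quadForm, map_smul, inner_smul_left, inner_smul_right, ← mul_assoc]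
  rw [Complex.mul_conj', ← Complex.ofReal_pow, Complex.re_ofReal_mul]

theorem quadForm_add {H : E →L[ℂ] E} (hH : IsHermitianOp H) (x y : E) :
    quadForm H (x + y) = quadForm H x + quadForm H y + 2 * (inner ℂ (H x) y).re := by
  have h : (inner ℂ (H y) x).re = (inner ℂ (H x) y).re := by
    rw [hH y x, ← inner_conj_symm, Complex.conj_re]
  simp only [quadForm, map_add, inner_add_left, inner_add_right, Complex.add_re, h]
  ring

theorem IsHermitianOp.inner_self {H : E →L[ℂ] E} (hH : IsHermitianOp H) (x : E) :
    inner ℂ (H x) x = (quadForm H x : ℂ) := by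
  refine Complex.ext rfl ?_
  have : (starRingEnd ℂ) (inner ℂ (H x) x) = inner ℂ (H x) x := by
    rw [inner_conj_symm, hH x x]
  simpa using Complex.conj_eq_iff_im.1 this

theorem IsHermitianOp.inner_comm_eq_zero {H : E →L[ℂ] E} (hH : IsHermitianOp H) {x y : E}
    (h : inner ℂ (H x) y = 0) : inner ℂ (H y) x = 0 := by
  rw [hH y x, ← inner_conj_symm, h, map_zero]

theorem continuous_quadForm : Continuous fun p : (E →L[ℂ] E) × E => quadForm p.1 p.2 := by
  unfold quadForm
  fun_prop

theorem abs_quadForm_le (H : E →L[ℂ] E) (x : E) : |quadForm H x| ≤ ‖H‖ * ‖x‖ ^ 2 := by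
  refine (Complex.abs_re_le_norm _).trans ((norm_inner_le_norm _ _).trans ?_)
  have := H.le_opNorm x
  nlinarith [norm_nonneg x]

/-- Cauchy–Schwarz for a semidefinite form: isotropic vectors are in the radical. -/
theorem inner_eq_zero_of_quadForm_nonneg {H : E →L[ℂ] E} (hH : IsHermitianOp H)
    {W : Submodule ℂ E} (hW : ∀ x ∈ W, 0 ≤ quadForm H x) {x y : E} (hx : x ∈ W) (hy : y ∈ W)
    (h0 : quadForm H x = 0) : inner ℂ (H x) y = 0 := by
  apply hH.inner_comm_eq_zero
  by_contra hne
  set z := inner ℂ (H y) x with hz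
  have hzpos : 0 < ‖z‖ ^ 2 := by positivity
  have key : ∀ t : ℝ, 0 ≤ quadForm H y + 2 * t * ‖z‖ ^ 2 := by
    intro t
    have h1 := hW (y + ((t : ℂ) * (starRingEnd ℂ) z) • x) (W.add_mem hy (W.smul_mem _ hx))
    rw [quadForm_add hH, quadForm_smul, h0, inner_smul_right, ← hz, mul_assoc,
      Complex.conj_mul', ← Complex.ofReal_pow, ← Complex.ofReal_mul, Complex.ofReal_re] at h1
    linarith
  have := key (-(quadForm H y + 1) / (2 * ‖z‖ ^ 2))
  have h2 : 2 * (-(quadForm H y + 1) / (2 * ‖z‖ ^ 2)) * ‖z‖ ^ 2 = -(quadForm H y + 1) := by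
    field_simp
  linarith

/-- `H` is nonnegative on some subspace of `S` of dimension at least `k`. -/
def HasNonneg (H : E →L[ℂ] E) (S : Submodule ℂ E) (k : ℕ) : Prop :=
  ∃ W ≤ S, k ≤ finrank ℂ W ∧ ∀ x ∈ W, 0 ≤ quadForm H x

/-- `H` is positive definite on some subspace of `S` of dimension at least `k`. -/
def HasPos (H : E →L[ℂ] E) (S : Submodule ℂ E) (k : ℕ) : Prop :=
  ∃ W ≤ S, k ≤ finrank ℂ W ∧ ∀ x ∈ W, x ≠ 0 → 0 < quadForm H x

/-- `A` and `B` both vanish on some `k`-dimensional subspace of `S`. -/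
def HasIsotropic (A B : E →L[ℂ] E) (S : Submodule ℂ E) (k : ℕ) : Prop :=
  ∃ Z ≤ S, finrank ℂ Z = k ∧ ∀ x ∈ Z, quadForm A x = 0 ∧ quadForm B x = 0

variable [FiniteDimensional ℂ E]

/-- Represent the subspaces by orthonormal `k`-frames. These live in a compact set, and
orthonormality survives the limit, so the limiting subspace does not lose dimension. -/
theorem hasNonneg_of_tendsto {H : E →L[ℂ] E} {Hs : ℕ → E →L[ℂ] E} {S : Submodule ℂ E} {k : ℕ}
    (hlim : Filter.Tendsto Hs Filter.atTop (nhds H)) (h : ∀ m, HasNonneg (Hs m) S k) :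
    HasNonneg H S k := by
  have hframe : ∀ m, ∃ v : Fin k → E, Orthonormal ℂ v ∧ (∀ i, v i ∈ S) ∧
      ∀ c : Fin k → ℂ, 0 ≤ quadForm (Hs m) (∑ i, c i • v i) := by
    intro m
    obtain ⟨W, hWS, hk, hW⟩ := h m
    let b := stdOrthonormalBasis ℂ W
    refine ⟨fun i => (b (Fin.castLE hk i) : E), ?_, fun i => hWS (b _).2, fun c => hW _ ?_⟩
    · exact (b.orthonormal.comp_linearIsometry W.subtypeₗᵢ).comp _ (Fin.castLE_injective hk)
    · exact W.sum_mem fun i _ => W.smul_mem _ (b _).2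
  choose v hv hvS hvH using hframe
  have hcpt : IsCompact (Set.pi Set.univ fun _ : Fin k => Metric.closedBall (0 : E) 1) :=
    have := FiniteDimensional.proper ℂ E
    isCompact_univ_pi fun _ => isCompact_closedBall _ _
  obtain ⟨w, -, φ, hφ, hw⟩ := hcpt.tendsto_subseq (x := v)
    (fun m i _ => by simp [(hv m).1 i])
  have hwi : ∀ i, Filter.Tendsto (fun m => v (φ m) i) Filter.atTop (nhds (w i)) :=
    fun i => (tendsto_pi_nhds.1 hw) i
  have horth : Orthonormal ℂ w := by
    classical
    rw [orthonormal_iff_ite]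
    intro i j
    refine tendsto_nhds_unique ((hwi i).inner (hwi j)) ?_
    simp only [fun m => (orthonormal_iff_ite.1 (hv (φ m))) i j]
    exact tendsto_const_nhds
  have hwS : ∀ i, w i ∈ S := fun i =>
    (Submodule.closed_of_finiteDimensional S).mem_of_tendsto (hwi i)
      (Filter.Eventually.of_forall fun m => hvS (φ m) i)
  refine ⟨Submodule.span ℂ (Set.range w), Submodule.span_le.2 (by rintro _ ⟨i, rfl⟩; exact hwS i),
    ?_, fun x hx => ?_⟩
  · rw [finrank_span_eq_card horth.linearIndependent, Fintype.card_fin]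
  · obtain ⟨c, rfl⟩ := (Submodule.mem_span_range_iff_exists_fun ℂ).1 hx
    refine ge_of_tendsto (x := Filter.atTop)
      (f := fun m => quadForm (Hs (φ m)) (∑ i, c i • v (φ m) i)) ?_
      (Filter.Eventually.of_forall fun m => hvH (φ m) c)
    have h2 : Filter.Tendsto (fun m => ∑ i, c i • v (φ m) i) Filter.atTop
        (nhds (∑ i, c i • w i)) := tendsto_finsetSum _ fun i _ => (hwi i).const_smul (c i)
    exact (continuous_quadForm.tendsto (H, _)).comp
      ((hlim.comp hφ.tendsto_atTop).prodMk_nhds h2)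

/-- A form which is positive definite on a subspace is coercive there. -/
theorem exists_coercive {H : E →L[ℂ] E} {W : Submodule ℂ E}
    (hW : ∀ x ∈ W, x ≠ 0 → 0 < quadForm H x) :
    ∃ ε > 0, ∀ x ∈ W, ε * ‖x‖ ^ 2 ≤ quadForm H x := by
  have := FiniteDimensional.proper ℂ E
  have hcpt : IsCompact ((W : Set E) ∩ Metric.sphere 0 1) :=
    (isCompact_sphere _ _).inter_left (Submodule.closed_of_finiteDimensional W)
  have hcont : Continuous (quadForm H) := continuous_quadForm.comp (by fun_prop :
    Continuous fun x : E => (H, x))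
  rcases ((W : Set E) ∩ Metric.sphere 0 1).eq_empty_or_nonempty with he | hne
  · refine ⟨1, one_pos, fun x hx => ?_⟩
    have hx0 : x = 0 := by
      by_contra hx0
      have : ((‖x‖ : ℂ)⁻¹ • x) ∈ ((W : Set E) ∩ Metric.sphere 0 1) :=
        ⟨W.smul_mem _ hx, by simp [norm_smul, hx0]⟩
      rw [he] at this
      exact this
    simp [hx0, quadForm_zero]
  · obtain ⟨x₀, ⟨hx₀W, hx₀⟩, hmin⟩ := hcpt.exists_isMinOn hne hcont.continuousOn
    have hx₀0 : x₀ ≠ 0 := by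
      rintro rfl
      simp at hx₀
    refine ⟨quadForm H x₀, hW x₀ hx₀W hx₀0, fun x hx => ?_⟩
    rcases eq_or_ne x 0 with rfl | hx0
    · simp [quadForm_zero]
    have hxn : 0 < ‖x‖ := norm_pos_iff.2 hx0
    have h1 : quadForm H x₀ ≤ quadForm H ((‖x‖ : ℂ)⁻¹ • x) :=
      hmin ⟨W.smul_mem _ hx, by simp [norm_smul, hx0]⟩
    rw [quadForm_smul] at h1
    simp only [norm_inv, Complex.norm_real, norm_norm, inv_pow] at h1
    rwa [inv_mul_eq_div, le_div_iff₀ (by positivity)] at h1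

/-- The coercivity constant bounds the admissible perturbation. This is the openness that
complements the closedness in `hasNonneg_of_tendsto`; together they drive the boundary arguments. -/
theorem HasPos.exists_hasNonneg_of_norm_sub_lt {H : E →L[ℂ] E} {S : Submodule ℂ E} {k : ℕ}
    (h : HasPos H S k) : ∃ ε > 0, ∀ H' : E →L[ℂ] E, ‖H' - H‖ < ε → HasNonneg H' S k := by
  obtain ⟨W, hWS, hk, hW⟩ := h
  obtain ⟨ε, hε, hc⟩ := exists_coercive hW
  refine ⟨ε, hε, fun H' hH' => ⟨W, hWS, hk, fun x hx => ?_⟩⟩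
  have h1 := hc x hx
  have h2 := neg_le_of_abs_le (abs_quadForm_le (H' - H) x)
  have h3 : quadForm (H' - H) x = quadForm H' x - quadForm H x := by
    simp [quadForm]
  have h4 : ‖H' - H‖ * ‖x‖ ^ 2 ≤ ε * ‖x‖ ^ 2 := by gcongr
  linarith

/-- Sylvester splitting of a Hermitian form on `S` into a maximal positive definite subspace and
its orthogonal with respect to the form. -/
theorem exists_splitting {H : E →L[ℂ] E} (hH : IsHermitianOp H) (S : Submodule ℂ E) :
    ∃ P ≤ S, ∃ N ≤ S, (∀ x ∈ P, x ≠ 0 → 0 < quadForm H x) ∧ (∀ x ∈ N, quadForm H x ≤ 0) ∧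
      finrank ℂ P + finrank ℂ N = finrank ℂ S ∧
      ∀ x ∈ N, quadForm H x = 0 → ∀ y ∈ S, inner ℂ (H x) y = 0 := by
  let T : Set (Submodule ℂ E) := {P | P ≤ S ∧ ∀ x ∈ P, x ≠ 0 → 0 < quadForm H x}
  have hT : (⊥ : Submodule ℂ E) ∈ T :=
    ⟨bot_le, fun x hx h0 => absurd ((Submodule.mem_bot ℂ).1 hx) h0⟩
  obtain ⟨P, ⟨hPS, hP⟩, hmax⟩ :
      ∃ P ∈ T, ∀ Q ∈ T, ¬ P < Q := by
    obtain ⟨P, hP, hmax⟩ := WellFounded.has_min (wellFounded_gt (α := Submodule ℂ E)) T ⟨⊥, hT⟩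
    exact ⟨P, hP, fun Q hQ h => hmax Q hQ h⟩
  -- The orthogonal of `P` in `S` for the form itself; it has codimension at most `dim P` in `S`.
  let N : Submodule ℂ E := (P.map (H : E →ₗ[ℂ] E))ᗮ ⊓ S
  have hN : ∀ y ∈ N, ∀ u ∈ P, inner ℂ (H u) y = 0 := fun y hy u hu =>
    (Submodule.mem_orthogonal _ _).1 hy.1 _ (Submodule.mem_map_of_mem hu)
  have hdisj : P ⊓ N = ⊥ := by
    rw [Submodule.eq_bot_iff]
    rintro x ⟨hxP, hxN⟩
    by_contra h0
    have := hP x hxP h0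
    rw [quadForm, hN x hxN x hxP] at this
    simp at this
  have hsup : P ⊔ N ≤ S := sup_le hPS inf_le_right
  have hdim1 := Submodule.finrank_sup_add_finrank_inf_eq P N
  rw [hdisj, finrank_bot, add_zero] at hdim1
  have hdim2 : finrank ℂ S ≤ finrank ℂ P + finrank ℂ N := by
    have h1 := Submodule.finrank_sup_add_finrank_inf_eq (P.map (H : E →ₗ[ℂ] E))ᗮ S
    have h2 := Submodule.finrank_le ((P.map (H : E →ₗ[ℂ] E))ᗮ ⊔ S)
    have h3 := Submodule.finrank_add_finrank_orthogonal (P.map (H : E →ₗ[ℂ] E))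
    have h4 := Submodule.finrank_map_le (H : E →ₗ[ℂ] E) P
    change _ + finrank ℂ N = _ at h1
    omega
  have hSeq : P ⊔ N = S := Submodule.eq_of_le_of_finrank_le hsup (by omega)
  have hneg : ∀ x ∈ N, quadForm H x ≤ 0 := by
    intro y hy
    by_contra! hpos
    have hy0 : y ≠ 0 := by
      rintro rfl
      simp [quadForm_zero] at hpos
    have hyP : y ∉ P := fun h => hy0 ((Submodule.eq_bot_iff _).1 hdisj y ⟨h, hy⟩)
    -- A positive vector of `N` could be adjoined to `P`, since cross terms vanish, contradicting
    -- maximality.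
    refine hmax (P ⊔ Submodule.span ℂ {y})
      ⟨sup_le hPS ((Submodule.span_singleton_le_iff_mem _ _).2 hy.2), ?_⟩ ?_
    · intro x hx hx0
      obtain ⟨u, hu, z, hz, rfl⟩ := Submodule.mem_sup.1 hx
      obtain ⟨c, rfl⟩ := Submodule.mem_span_singleton.1 hz
      rw [quadForm_add hH, quadForm_smul, inner_smul_right, hN y hy u hu]
      simp only [mul_zero, Complex.zero_re, add_zero]
      rcases eq_or_ne u 0 with rfl | hu0
      · have hc : c ≠ 0 := by
          rintro rfl
          simp at hx0
        rw [quadForm_zero]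
        positivity
      · have := hP u hu hu0
        positivity
    · refine lt_of_le_of_ne le_sup_left fun heq => hyP ?_
      rw [heq]
      exact Submodule.mem_sup_right (Submodule.mem_span_singleton_self y)
  refine ⟨P, hPS, N, inf_le_right, hP, hneg, by rw [← hdim1, hSeq], fun x hx hx0 y hy => ?_⟩
  rw [← hSeq] at hy
  obtain ⟨u, hu, z, hz, rfl⟩ := Submodule.mem_sup.1 hy
  rw [inner_add_right, hH.inner_comm_eq_zero (hN x hx u hu), zero_add]
  have hH' : IsHermitianOp (-H) := fun x y => by simp [hH x y]
  have := inner_eq_zero_of_quadForm_nonneg hH' (W := N)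
    (fun x hx => by rw [quadForm_neg]; linarith [hneg x hx]) hx hz
    (by rw [quadForm_neg, hx0, neg_zero])
  simpa using this

end HermitianForms

/-! ### Finding and splitting off common isotropic vectors -/

section IsotropicSubspaces

variable {E : Type*} [NormedAddCommGroup E] [InnerProductSpace ℂ E]

/-- Along the real line `u + t v` the form is a quadratic polynomial in `t` whose end coefficients
have opposite signs, hence a real root exists. -/
theorem exists_isotropic_of_nonneg_of_nonpos {D : E →L[ℂ] E} (hD : IsHermitianOp D)
    (R : Submodule ℂ E) {u v : E} (hu : u ∈ R) (hv : v ∈ R) (hu0 : u ≠ 0) (hv0 : v ≠ 0)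
    (hDu : 0 ≤ quadForm D u) (hDv : quadForm D v ≤ 0) : ∃ x ∈ R, x ≠ 0 ∧ quadForm D x = 0 := by
  rcases hDu.eq_or_lt with h | hDu
  · exact ⟨u, hu, hu0, h.symm⟩
  rcases hDv.eq_or_lt with h | hDv
  · exact ⟨v, hv, hv0, h⟩
  set c := (inner ℂ (D u) v).re with hc
  have hdisc : ∃ s, discrim (quadForm D v) (2 * c) (quadForm D u) = s * s := by
    refine ⟨Real.sqrt (discrim (quadForm D v) (2 * c) (quadForm D u)), ?_⟩
    rw [Real.mul_self_sqrt]
    unfold discrim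
    nlinarith [sq_nonneg c, mul_pos hDu (neg_pos.2 hDv)]
  obtain ⟨t, ht⟩ := exists_quadratic_eq_zero hDv.ne hdisc
  refine ⟨u + (t : ℂ) • v, R.add_mem hu (R.smul_mem _ hv), fun h0 => ?_, ?_⟩
  · have h1 : u = (-(t : ℂ)) • v := by rw [neg_smul]; exact eq_neg_of_add_eq_zero_left h0
    rw [h1, quadForm_smul] at hDu
    nlinarith [sq_nonneg ‖-(t : ℂ)‖]
  · rw [quadForm_add hD, quadForm_smul, inner_smul_right, Complex.re_ofReal_mul, ← hc,
      Complex.norm_real, Real.norm_eq_abs, sq_abs]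
    linarith

variable [FiniteDimensional ℂ E]

theorem finrank_le_finrank_orthogonal_singleton_inf (v : E) (M : Submodule ℂ E) :
    finrank ℂ M ≤ finrank ℂ ((Submodule.span ℂ {v})ᗮ ⊓ M : Submodule ℂ E) + 1 := by
  have h1 := Submodule.finrank_sup_add_finrank_inf_eq (Submodule.span ℂ {v})ᗮ M
  have h2 := Submodule.finrank_le ((Submodule.span ℂ {v})ᗮ ⊔ M)
  have h3 := Submodule.finrank_add_finrank_orthogonal (Submodule.span ℂ {v})
  have h4 : finrank ℂ (Submodule.span ℂ {v}) ≤ 1 := by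
    simpa using finrank_span_le_card (R := ℂ) ({v} : Set E)
  omega

theorem finrank_sup_span_singleton_of_notMem {M : Submodule ℂ E} {x : E} (hx : x ∉ M) :
    finrank ℂ (M ⊔ Submodule.span ℂ {x} : Submodule ℂ E) = finrank ℂ M + 1 := by
  have hx0 : x ≠ 0 := fun h => hx (h ▸ M.zero_mem)
  have h1 := Submodule.finrank_sup_add_finrank_inf_eq M (Submodule.span ℂ {x})
  have h2 : M ⊓ Submodule.span ℂ {x} = ⊥ := by
    rw [← disjoint_iff]
    exact Submodule.disjoint_span_singleton.2 fun h => absurd h hx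
  rw [h2, finrank_bot, finrank_span_singleton hx0] at h1
  exact h1

theorem continuous_realComb (A B : E →L[ℂ] E) :
    Continuous fun p : ℝ × ℝ => realComb A B p.1 p.2 := by
  unfold realComb
  fun_prop

/-- Nonnegative subspaces survive, with a loss of one dimension, in the orthogonal of an isotropic
vector `x`, for those combinations of `A` and `B` under which `x` is generic. -/
theorem hasNonneg_orthogonal_of_generic {A B : E →L[ℂ] E} (hA : IsHermitianOp A)
    (hB : IsHermitianOp B) {S : Submodule ℂ E} {k : ℕ} {x : E} (hx : x ∈ S)
    (hAx : quadForm A x = 0) (hBx : quadForm B x = 0) {α β : ℂ}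
    (hdep : ∀ y ∈ S, α * inner ℂ (A x) y + β * inner ℂ (B x) y = 0) {a b : ℝ}
    (hP : HasNonneg (realComb A B a b) S (k + 1)) (hab : a * β - b * α ≠ 0) :
    HasNonneg (realComb A B a b) ((Submodule.span ℂ {x})ᗮ ⊓ ((Submodule.span ℂ {A x})ᗮ ⊓
      ((Submodule.span ℂ {B x})ᗮ ⊓ S))) k := by
  obtain ⟨W, hWS, hk, hW⟩ := hP
  have hH := hA.realComb hB a b
  set H := realComb A B a b with hHdef
  have hHx : quadForm H x = 0 := by rw [hHdef, quadForm_realComb, hAx, hBx]; ring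
  let W1 : Submodule ℂ E := (Submodule.span ℂ {H x})ᗮ ⊓ W
  have hW1 : ∀ y ∈ W1, inner ℂ (H x) y = 0 := fun y hy =>
    Submodule.mem_orthogonal_singleton_iff_inner_right.1 hy.1
  -- If `x ∈ W`, Cauchy–Schwarz shows that passing to `W1` loses nothing; otherwise the dimension
  -- lost is regained by adjoining `x`.
  have hdim : k + 1 ≤ finrank ℂ (W1 ⊔ Submodule.span ℂ {x} : Submodule ℂ E) := by
    by_cases hxW : x ∈ W
    · have hle : W ≤ W1 := fun y hy => ⟨Submodule.mem_orthogonal_singleton_iff_inner_right.2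
        (inner_eq_zero_of_quadForm_nonneg hH hW hxW hy hHx), hy⟩
      exact hk.trans (Submodule.finrank_mono (hle.trans le_sup_left))
    · rw [finrank_sup_span_singleton_of_notMem fun h : x ∈ W1 => hxW h.2]
      have := finrank_le_finrank_orthogonal_singleton_inf (H x) W
      change _ ≤ finrank ℂ W1 + 1 at this
      omega
  refine ⟨(Submodule.span ℂ {x})ᗮ ⊓ (W1 ⊔ Submodule.span ℂ {x}), ?_, ?_, ?_⟩
  · rintro y ⟨hy1, hy2⟩
    have hyS : y ∈ S := by
      refine (sup_le (inf_le_right.trans hWS) ?_ : W1 ⊔ Submodule.span ℂ {x} ≤ S) hy2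
      exact (Submodule.span_singleton_le_iff_mem _ _).2 hx
    have hHy : inner ℂ (H x) y = 0 := by
      obtain ⟨w, hw, z, hz, rfl⟩ := Submodule.mem_sup.1 hy2
      obtain ⟨c, rfl⟩ := Submodule.mem_span_singleton.1 hz
      rw [inner_add_right, hW1 w hw, inner_smul_right, hH.inner_self, hHx]
      simp
    rw [hHdef, inner_realComb] at hHy
    have hd := hdep y hyS
    refine ⟨hy1, Submodule.mem_orthogonal_singleton_iff_inner_right.2 ?_,
      Submodule.mem_orthogonal_singleton_iff_inner_right.2 ?_, hyS⟩
    -- The equations `hHy` and `hd` form a linear system in `inner (A x) y` and `inner (B x) y` with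
    -- determinant `a * β - b * α`.
    · refine (mul_eq_zero.1 ?_).resolve_left hab
      linear_combination β * hHy - b * hd
    · refine (mul_eq_zero.1 ?_).resolve_left hab
      linear_combination -α * hHy + a * hd
  · have := finrank_le_finrank_orthogonal_singleton_inf x (W1 ⊔ Submodule.span ℂ {x})
    omega
  · rintro y ⟨-, hy2⟩
    obtain ⟨w, hw, z, hz, rfl⟩ := Submodule.mem_sup.1 hy2
    obtain ⟨c, rfl⟩ := Submodule.mem_span_singleton.1 hz
    rw [quadForm_add hH, quadForm_smul, hHx, inner_smul_right,
      hH.inner_comm_eq_zero (hW1 w hw)]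
    simpa using hW w hw.2

/-- Splitting off an isotropic vector `x` at which the two forms are linearly dependent. -/
theorem hasIsotropic_succ_of_dependent {A B : E →L[ℂ] E} (hA : IsHermitianOp A)
    (hB : IsHermitianOp B) {S : Submodule ℂ E} {k : ℕ}
    (IH : ∀ S' : Submodule ℂ E, (∀ a b, HasNonneg (realComb A B a b) S' k) →
      HasIsotropic A B S' k)
    (hP : ∀ a b, HasNonneg (realComb A B a b) S (k + 1)) {x : E} (hx : x ∈ S) (hx0 : x ≠ 0)
    (hAx : quadForm A x = 0) (hBx : quadForm B x = 0) {α β : ℂ} (hαβ : α ≠ 0 ∨ β ≠ 0)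
    (hdep : ∀ y ∈ S, α * inner ℂ (A x) y + β * inner ℂ (B x) y = 0) :
    HasIsotropic A B S (k + 1) := by
  have hgen := fun (a b : ℝ) (hab : a * β - b * α ≠ 0) =>
    hasNonneg_orthogonal_of_generic hA hB hx hAx hBx hdep (hP a b) hab
  -- A generic direction: moving an exceptional `(a, b)` slightly along `(p, q)` makes it generic,
  -- and the limit recovers the exceptional case.
  obtain ⟨p, q, hpq⟩ : ∃ p q : ℝ, p * β - q * α ≠ 0 := by
    rcases hαβ with h | h
    · exact ⟨0, 1, by simpa using h⟩
    · exact ⟨1, 0, by simpa using h⟩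
  obtain ⟨Z, hZS, hZk, hZ⟩ := IH _ fun a b => by
    by_cases hab : a * β - b * α = 0
    · have ht : Filter.Tendsto (fun m : ℕ => (a + 1 / ((m : ℝ) + 1) * p,
          b + 1 / ((m : ℝ) + 1) * q)) Filter.atTop (nhds (a, b)) := by
        have h0 := tendsto_one_div_add_atTop_nhds_zero_nat (𝕜 := ℝ)
        simpa using (h0.mul_const p).const_add a |>.prodMk_nhds ((h0.mul_const q).const_add b)
      refine hasNonneg_of_tendsto (((continuous_realComb A B).tendsto (a, b)).comp ht)
        fun m => hgen _ _ ?_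
      have hm : (1 / ((m : ℂ) + 1)) ≠ 0 := one_div_ne_zero (Nat.cast_add_one_ne_zero m)
      have : ((a + 1 / ((m : ℝ) + 1) * p : ℝ) : ℂ) * β - ((b + 1 / ((m : ℝ) + 1) * q : ℝ) : ℂ) * α
          = 1 / ((m : ℂ) + 1) * (p * β - q * α) := by
        push_cast
        linear_combination hab
      rw [this]
      exact mul_ne_zero hm hpq
    · exact hgen a b hab
  have hxZ : x ∉ Z := fun h => hx0 (inner_self_eq_zero (𝕜 := ℂ).1
    (Submodule.mem_orthogonal_singleton_iff_inner_right.1 (hZS h).1))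
  refine ⟨Z ⊔ Submodule.span ℂ {x}, sup_le (fun y hy => (hZS hy).2.2.2)
    ((Submodule.span_singleton_le_iff_mem _ _).2 hx), ?_, fun y hy => ?_⟩
  · rw [finrank_sup_span_singleton_of_notMem hxZ, hZk]
  · obtain ⟨z, hz, w, hw, rfl⟩ := Submodule.mem_sup.1 hy
    obtain ⟨c, rfl⟩ := Submodule.mem_span_singleton.1 hw
    have h1 := hA.inner_comm_eq_zero
      (Submodule.mem_orthogonal_singleton_iff_inner_right.1 (hZS hz).2.1)
    have h2 := hB.inner_comm_eq_zero
      (Submodule.mem_orthogonal_singleton_iff_inner_right.1 (hZS hz).2.2.1)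
    rw [quadForm_add hA, quadForm_add hB, quadForm_smul, quadForm_smul, hAx, hBx,
      inner_smul_right, inner_smul_right, h1, h2, (hZ z hz).1, (hZ z hz).2]
    simp

/-- If `A` and `B` are nonnegative in all directions but some combination `H` fails to be
positive, then `H` has a radical vector isotropic for both forms. -/
theorem exists_radical_isotropic {A B : E →L[ℂ] E} (hA : IsHermitianOp A)
    (hB : IsHermitianOp B) {S : Submodule ℂ E} {k : ℕ}
    (hP : ∀ a b, HasNonneg (realComb A B a b) S k) {a b : ℝ} (hab : a ≠ 0 ∨ b ≠ 0)
    (hns : ¬ HasPos (realComb A B a b) S k) :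
    ∃ x ∈ S, x ≠ 0 ∧ quadForm A x = 0 ∧ quadForm B x = 0 ∧
      ∀ y ∈ S, inner ℂ (realComb A B a b x) y = 0 := by
  have hH := hA.realComb hB a b
  obtain ⟨P, hPS, N, hNS, hPpos, hNneg, hdim, hrad⟩ := exists_splitting hH S
  have hPk : finrank ℂ P < k := by
    by_contra! h
    exact hns ⟨P, hPS, h, hPpos⟩
  -- Perturb `H` slightly towards `a' A + b' B`. Since `dim P < k`, a `k`-dimensional nonnegative
  -- subspace of the perturbed form meets `N`, where `H ≤ 0`; unit vectors from these intersections
  -- accumulate at the required `x`.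
  have haux : ∀ a' b' : ℝ, ∃ x ∈ N, x ≠ 0 ∧ quadForm (realComb A B a b) x = 0 ∧
      0 ≤ quadForm (realComb A B a' b') x := by
    intro a' b'
    have hseq : ∀ m : ℕ, ∃ x ∈ (N : Set E) ∩ Metric.sphere 0 1,
        0 ≤ quadForm (realComb A B a b) x +
          1 / ((m : ℝ) + 1) * quadForm (realComb A B a' b') x := by
      intro m
      obtain ⟨W, hWS, hk, hW⟩ := hP (a + 1 / ((m : ℝ) + 1) * a') (b + 1 / ((m : ℝ) + 1) * b')
      have hne : W ⊓ N ≠ ⊥ := by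
        intro h
        have h1 := Submodule.finrank_sup_add_finrank_inf_eq W N
        rw [h, finrank_bot] at h1
        have h2 := Submodule.finrank_mono (sup_le hWS hNS)
        omega
      obtain ⟨x, ⟨hxW, hxN⟩, hx0⟩ := Submodule.exists_mem_ne_zero_of_ne_bot hne
      refine ⟨(‖x‖ : ℂ)⁻¹ • x, ⟨N.smul_mem _ hxN, by simp [norm_smul, hx0]⟩, ?_⟩
      have h1 := hW _ (W.smul_mem ((‖x‖ : ℂ)⁻¹) hxW)
      rw [quadForm_realComb] at h1
      rw [quadForm_realComb, quadForm_realComb]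
      linarith
    choose x hx hxm using hseq
    have := FiniteDimensional.proper ℂ E
    have hcpt : IsCompact ((N : Set E) ∩ Metric.sphere 0 1) :=
      (isCompact_sphere _ _).inter_left (Submodule.closed_of_finiteDimensional N)
    obtain ⟨w, ⟨hwN, hw1⟩, φ, hφ, hw⟩ := hcpt.tendsto_subseq hx
    have hlim : ∀ H : E →L[ℂ] E, Filter.Tendsto (fun m => quadForm H (x (φ m))) Filter.atTop
        (nhds (quadForm H w)) := fun H =>
      (continuous_quadForm.tendsto (H, w)).comp (tendsto_const_nhds.prodMk_nhds hw)
    refine ⟨w, hwN, ?_, le_antisymm (hNneg w hwN) ?_, ?_⟩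
    · rintro rfl
      simp at hw1
    · have h0 := (tendsto_one_div_add_atTop_nhds_zero_nat (𝕜 := ℝ)).comp hφ.tendsto_atTop
      have := (hlim (realComb A B a b)).add (h0.mul (hlim (realComb A B a' b')))
      rw [zero_mul, add_zero] at this
      exact ge_of_tendsto this (Filter.Eventually.of_forall fun m => hxm (φ m))
    · refine ge_of_tendsto (hlim _) (Filter.Eventually.of_forall fun m => ?_)
      have h1 := hxm (φ m)
      have h2 := hNneg _ (hx (φ m)).1
      have h3 : 0 < 1 / ((φ m : ℝ) + 1) := by positivity
      by_contra! h4
      nlinarith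
  -- The direction `(-b, a)` is perpendicular to `(a, b)`. Both signs are used, so the form `-b A +
  -- a B` takes both weak signs on the radical of `H`.
  obtain ⟨u, huN, hu0, huH, huD⟩ := haux (-b) a
  obtain ⟨v, hvN, hv0, hvH, hvD⟩ := haux b (-a)
  let R : Submodule ℂ E :=
    { carrier := {x | x ∈ S ∧ ∀ y ∈ S, inner ℂ (realComb A B a b x) y = 0}
      add_mem' := fun {x y} hx hy => ⟨S.add_mem hx.1 hy.1, fun z hz => by
        rw [map_add, inner_add_left, hx.2 z hz, hy.2 z hz, add_zero]⟩
      zero_mem' := ⟨S.zero_mem, fun z _ => by rw [map_zero, inner_zero_left]⟩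
      smul_mem' := fun c x hx => ⟨S.smul_mem c hx.1, fun z hz => by
        rw [map_smul, inner_smul_left, hx.2 z hz, mul_zero]⟩ }
  obtain ⟨x, hxR, hx0, hxD⟩ := exists_isotropic_of_nonneg_of_nonpos (hA.realComb hB (-b) a) R
    (u := u) (v := v) ⟨hNS huN, hrad u huN huH⟩ ⟨hNS hvN, hrad v hvN hvH⟩ hu0 hv0 huD (by
      rw [quadForm_realComb] at hvD ⊢
      linarith)
  have hxH : quadForm (realComb A B a b) x = 0 := by
    rw [quadForm, hxR.2 x hxR.1, Complex.zero_re]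
  rw [quadForm_realComb] at hxH hxD
  -- The determinant of the system that recovers the values of `A` and `B` at `x` from those of the
  -- two perpendicular combinations.
  have hpos : a ^ 2 + b ^ 2 ≠ 0 := by
    rcases hab with h | h <;> positivity
  refine ⟨x, hxR.1, hx0, ?_, ?_, hxR.2⟩
  · refine (mul_eq_zero.1 ?_).resolve_left hpos
    linear_combination a * hxH - b * hxD
  · refine (mul_eq_zero.1 ?_).resolve_left hpos
    linear_combination b * hxH + a * hxD

/-- The radical vector of `a A + b B` is a dependent isotropic vector with coefficients `(a, b)`, so
it splits off. -/
theorem hasIsotropic_succ_of_not_hasPos {A B : E →L[ℂ] E} (hA : IsHermitianOp A)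
    (hB : IsHermitianOp B) {S : Submodule ℂ E} {k : ℕ}
    (IH : ∀ S' : Submodule ℂ E, (∀ a b, HasNonneg (realComb A B a b) S' k) →
      HasIsotropic A B S' k)
    (hP : ∀ a b, HasNonneg (realComb A B a b) S (k + 1)) {a b : ℝ} (hab : a ≠ 0 ∨ b ≠ 0)
    (hns : ¬ HasPos (realComb A B a b) S (k + 1)) : HasIsotropic A B S (k + 1) := by
  obtain ⟨x, hx, hx0, hAx, hBx, hr⟩ := exists_radical_isotropic hA hB hP hab hns
  refine hasIsotropic_succ_of_dependent hA hB IH hP hx hx0 hAx hBx (α := a) (β := b)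
    (by exact_mod_cast hab) fun y hy => ?_
  rw [← inner_realComb]
  exact hr y hy

end IsotropicSubspaces

/-! ### Common isotropic subspaces of two Hermitian forms -/

section HigherRankNumericalRange

variable {E : Type*} [NormedAddCommGroup E] [InnerProductSpace ℂ E]

/-- The translate `A - s • 1` of an operator by a real scalar. -/
noncomputable def shiftOp (A : E →L[ℂ] E) (s : ℝ) : E →L[ℂ] E :=
  A - (s : ℂ) • ContinuousLinearMap.id ℂ E

theorem IsHermitianOp.shiftOp {A : E →L[ℂ] E} (hA : IsHermitianOp A) (s : ℝ) :
    IsHermitianOp (shiftOp A s) := by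
  intro x y
  simp [_root_.shiftOp, hA x y]

theorem quadForm_shiftOp (A : E →L[ℂ] E) (s : ℝ) (x : E) :
    quadForm (shiftOp A s) x = quadForm A x - s * ‖x‖ ^ 2 := by
  have h := quadForm_id x
  simp only [quadForm] at h
  simp [quadForm, shiftOp, ← h]

theorem HasNonneg.of_forall_quadForm_eq {H H' : E →L[ℂ] E} {S : Submodule ℂ E} {k : ℕ} {c : ℝ}
    (hc : 0 < c) (heq : ∀ x, quadForm H' x = c * quadForm H x) (h : HasNonneg H' S k) :
    HasNonneg H S k := by
  obtain ⟨W, hWS, hk, hW⟩ := h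
  exact ⟨W, hWS, hk, fun x hx => nonneg_of_mul_nonneg_right (heq x ▸ hW x hx) hc⟩

theorem HasIsotropic.mono {A B : E →L[ℂ] E} {S T : Submodule ℂ E} {k : ℕ} (hST : S ≤ T)
    (h : HasIsotropic A B S k) : HasIsotropic A B T k := by
  obtain ⟨Z, hZS, hZ⟩ := h
  exact ⟨Z, hZS.trans hST, hZ⟩

variable [FiniteDimensional ℂ E]

/-- Moving in the direction of the identity up to the boundary of the set of admissible shifts. -/
theorem exists_shift_isotropic {A B : E →L[ℂ] E} (hA : IsHermitianOp A)
    (hB : IsHermitianOp B) {S : Submodule ℂ E} {k : ℕ}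
    (IH : ∀ (A' : E →L[ℂ] E), IsHermitianOp A' → ∀ S' : Submodule ℂ E,
      (∀ a b, HasNonneg (realComb A' B a b) S' k) → HasIsotropic A' B S' k)
    (hP : ∀ a b, HasNonneg (realComb A B a b) S (k + 1)) :
    ∃ s : ℝ, 0 ≤ s ∧ HasIsotropic (shiftOp A s) B S (k + 1) := by
  let T : Set ℝ := {s | 0 ≤ s ∧ ∀ a b, HasNonneg (realComb (shiftOp A s) B a b) S (k + 1)}
  have hcont : Continuous fun p : ℝ × ℝ × ℝ => realComb (shiftOp A p.1) B p.2.1 p.2.2 := by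
    unfold realComb shiftOp
    fun_prop
  have h0T : (0 : ℝ) ∈ T := ⟨le_rfl, fun a b => by
    have : shiftOp A 0 = A := by simp [shiftOp]
    rw [this]
    exact hP a b⟩
  have hbdd : BddAbove T := by
    refine ⟨‖A‖, fun s hs => ?_⟩
    obtain ⟨W, -, hk, hW⟩ := hs.2 1 0
    have hne : W ≠ ⊥ := by
      rintro rfl
      simp at hk
    obtain ⟨x, hxW, hx0⟩ := Submodule.exists_mem_ne_zero_of_ne_bot hne
    have h1 := hW x hxW
    rw [quadForm_realComb, quadForm_shiftOp] at h1
    have h2 := (le_abs_self _).trans (abs_quadForm_le A x)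
    have h3 : 0 < ‖x‖ ^ 2 := by positivity
    by_contra! h4
    nlinarith
  have hclosed : IsClosed T := by
    rw [← isSeqClosed_iff_isClosed]
    intro u s hu hlim
    refine ⟨ge_of_tendsto hlim (Filter.Eventually.of_forall fun m => (hu m).1), fun a b => ?_⟩
    refine hasNonneg_of_tendsto ((hcont.tendsto (s, a, b)).comp
      (hlim.prodMk_nhds tendsto_const_nhds)) fun m => (hu m).2 a b
  have hsT : sSup T ∈ T := hclosed.csSup_mem ⟨0, h0T⟩ hbdd
  set s := sSup T with hs
  suffices h : ∃ a b : ℝ, (a ≠ 0 ∨ b ≠ 0) ∧ ¬ HasPos (realComb (shiftOp A s) B a b) S (k + 1) by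
    obtain ⟨a, b, hab, hns⟩ := h
    exact ⟨s, hsT.1, hasIsotropic_succ_of_not_hasPos (hA.shiftOp s) hB
      (IH _ (hA.shiftOp s)) hsT.2 hab hns⟩
  by_contra! hpos
  -- Just beyond the supremum some direction fails. Normalized to the unit sphere, these directions
  -- accumulate at one where strict positivity at `s` and openness give a contradiction.
  have hseq : ∀ m : ℕ, ∃ p ∈ Metric.sphere (0 : ℝ × ℝ) 1,
      ¬ HasNonneg (realComb (shiftOp A (s + 1 / ((m : ℝ) + 1))) B p.1 p.2) S (k + 1) := by
    intro m
    have hm : 0 < 1 / ((m : ℝ) + 1) := by positivity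
    have hnot : s + 1 / ((m : ℝ) + 1) ∉ T := fun h => by
      have := le_csSup hbdd h
      linarith
    have : ∃ a b, ¬ HasNonneg (realComb (shiftOp A (s + 1 / ((m : ℝ) + 1))) B a b) S (k + 1) := by
      by_contra! h
      exact hnot ⟨by linarith [hsT.1], h⟩
    obtain ⟨a, b, hab⟩ := this
    have hne : (a, b) ≠ (0 : ℝ × ℝ) := by
      intro h
      obtain ⟨rfl, rfl⟩ := Prod.mk.inj h
      obtain ⟨W, hWS, hk, -⟩ := hP 0 0
      exact hab ⟨W, hWS, hk, fun x _ => by rw [quadForm_realComb]; simp⟩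
    have hn : 0 < ‖(a, b)‖ := norm_pos_iff.2 hne
    refine ⟨‖(a, b)‖⁻¹ • (a, b), ?_, fun h => hab ?_⟩
    · simp only [mem_sphere_zero_iff_norm, norm_smul, norm_inv, norm_norm]
      exact inv_mul_cancel₀ hn.ne'
    refine h.of_forall_quadForm_eq (inv_pos.2 hn) fun x => ?_
    rw [quadForm_realComb, quadForm_realComb]
    simp only [Prod.smul_mk, smul_eq_mul]
    ring
  choose p hp hpm using hseq
  obtain ⟨q, hq, φ, hφ, hlim⟩ := (isCompact_sphere (0 : ℝ × ℝ) 1).tendsto_subseq hp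
  have hq0 : q.1 ≠ 0 ∨ q.2 ≠ 0 := by
    by_contra! h
    have : q = 0 := Prod.ext h.1 h.2
    simp [this] at hq
  obtain ⟨ε, hε, hball⟩ := (hpos q.1 q.2 hq0).exists_hasNonneg_of_norm_sub_lt
  have h0 := (tendsto_one_div_add_atTop_nhds_zero_nat (𝕜 := ℝ)).comp hφ.tendsto_atTop
  have hs' := h0.const_add s
  rw [add_zero] at hs'
  have hl := (hcont.tendsto (s, q)).comp (hs'.prodMk_nhds hlim)
  obtain ⟨m, hm⟩ := (Metric.tendsto_nhds.1 hl ε hε).exists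
  rw [dist_eq_norm] at hm
  exact hpm (φ m) (hball _ hm)

/-- The dimension bound makes `S` the sum of a positive and a negative definite subspace. Pairing a
radical vector `u + v` with `u` and with `v` gives equal values of the form at `u` and `v`, so both
vanish. -/
theorem eq_zero_of_mem_radical {H : E →L[ℂ] E} (hH : IsHermitianOp H) {S : Submodule ℂ E} {k : ℕ}
    (hpos : HasPos H S k) (hneg : HasPos (-H) S k) (hS : finrank ℂ S ≤ 2 * k) {x : E}
    (hx : x ∈ S) (hrad : ∀ y ∈ S, inner ℂ (H x) y = 0) : x = 0 := by
  obtain ⟨P, hPS, hPk, hP⟩ := hpos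
  obtain ⟨N, hNS, hNk, hN⟩ := hneg
  have hdisj : P ⊓ N = ⊥ := by
    rw [Submodule.eq_bot_iff]
    rintro y ⟨hyP, hyN⟩
    by_contra h0
    have h1 := hP y hyP h0
    have h2 := hN y hyN h0
    rw [quadForm_neg] at h2
    linarith
  have hdim := Submodule.finrank_sup_add_finrank_inf_eq P N
  rw [hdisj, finrank_bot, add_zero] at hdim
  have hsup : P ⊔ N = S := Submodule.eq_of_le_of_finrank_le (sup_le hPS hNS) (by omega)
  rw [← hsup] at hx
  obtain ⟨u, hu, v, hv, rfl⟩ := Submodule.mem_sup.1 hx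
  have h1 := hH.inner_comm_eq_zero (hrad u (hPS hu))
  have h2 := hrad v (hNS hv)
  rw [inner_add_right] at h1
  rw [map_add, inner_add_left] at h2
  have h3 : quadForm H u = quadForm H v := by
    have := congrArg Complex.re (h1.trans h2.symm)
    simp only [Complex.add_re] at this
    unfold quadForm
    linarith
  have hu0 : u = 0 := by
    by_contra hu0
    have h4 := hP u hu hu0
    rcases eq_or_ne v 0 with rfl | hv0
    · rw [quadForm_zero] at h3
      linarith
    · have h5 := hN v hv hv0
      rw [quadForm_neg] at h5
      linarith
  subst hu0
  rw [quadForm_zero] at h3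
  by_contra hv0
  have h5 := hN v hv (by simpa using hv0)
  rw [quadForm_neg] at h5
  linarith

/-- A pencil of forms on a nonzero subspace on which the first form is nondegenerate has an
eigenvector. -/
theorem exists_pencil_eigenvector (A B : E →L[ℂ] E) {S : Submodule ℂ E} (hS : S ≠ ⊥)
    (hA : ∀ x ∈ S, (∀ y ∈ S, inner ℂ (A x) y = 0) → x = 0) :
    ∃ x ∈ S, x ≠ 0 ∧ ∃ μ : ℂ, ∀ y ∈ S, inner ℂ (B x) y = μ * inner ℂ (A x) y := by
  have : Nontrivial S := Submodule.nontrivial_iff_ne_bot.2 hS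
  let AS : S →ₗ[ℂ] S := S.orthogonalProjectionOnto.toLinearMap ∘ₗ A.toLinearMap ∘ₗ S.subtype
  let BS : S →ₗ[ℂ] S := S.orthogonalProjectionOnto.toLinearMap ∘ₗ B.toLinearMap ∘ₗ S.subtype
  have hAS : ∀ (x y : S), inner ℂ (AS x) y = inner ℂ (A x) (y : E) := fun x y =>
    Submodule.inner_orthogonalProjectionOnto_eq_of_mem_right y (A x)
  have hBS : ∀ (x y : S), inner ℂ (BS x) y = inner ℂ (B x) (y : E) := fun x y =>
    Submodule.inner_orthogonalProjectionOnto_eq_of_mem_right y (B x)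
  have hinj : Function.Injective AS := by
    rw [injective_iff_map_eq_zero]
    intro x hx
    refine Subtype.ext (hA x x.2 fun y hy => ?_)
    rw [← hAS x ⟨y, hy⟩, hx, inner_zero_left]
  let e := LinearEquiv.ofInjectiveEndo AS hinj
  obtain ⟨c, hc⟩ := Module.End.exists_eigenvalue (e.symm.toLinearMap ∘ₗ BS : Module.End ℂ S)
  obtain ⟨x, hx⟩ := hc.exists_hasEigenvector
  have hxe : BS x = c • AS x := by
    have h1 : e.symm (BS x) = c • x := hx.apply_eq_smul
    rw [LinearEquiv.symm_apply_eq, map_smul] at h1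
    exact h1
  refine ⟨x, x.2, by simpa using hx.2, (starRingEnd ℂ) c, fun y hy => ?_⟩
  rw [← hBS x ⟨y, hy⟩, hxe, inner_smul_left, hAS x ⟨y, hy⟩]

/-- If every real combination of two Hermitian forms is nonnegative on some `k`-dimensional
subspace, then the two forms vanish on a common `k`-dimensional subspace. -/
theorem hasIsotropic_of_forall_hasNonneg (k : ℕ) : ∀ {A B : E →L[ℂ] E}, IsHermitianOp A →
    IsHermitianOp B → ∀ {S : Submodule ℂ E},
    (∀ a b, HasNonneg (realComb A B a b) S k) → HasIsotropic A B S k := by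
  induction k with
  | zero =>
    intro A B _ _ S _
    refine ⟨⊥, bot_le, by simp, fun x hx => ?_⟩
    rw [(Submodule.mem_bot ℂ).1 hx]
    exact ⟨quadForm_zero _, quadForm_zero _⟩
  | succ k IH =>
    intro A B hA hB S hP
    obtain ⟨s, hs, U, hUS, hUk, hU⟩ := exists_shift_isotropic hA hB
      (fun A' hA' S' h => IH hA' hB h) hP
    have hA' : IsHermitianOp (-A) := fun x y => by simp [hA x y]
    obtain ⟨t, ht, V, hVS, hVk, hV⟩ := exists_shift_isotropic hA' hB
      (fun A' hA' S' h => IH hA' hB h) (S := S) fun a b =>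
        (hP (-a) b).of_forall_quadForm_eq one_pos fun x => by
          rw [quadForm_realComb, quadForm_realComb, quadForm_neg]
          ring
    simp only [quadForm_shiftOp, quadForm_neg] at hU hV
    rcases hs.eq_or_lt with rfl | hs
    · exact ⟨U, hUS, hUk, by simpa using hU⟩
    rcases ht.eq_or_lt with rfl | ht
    · exact ⟨V, hVS, hVk, by simpa using hV⟩
    -- On `U` the form `A` is a positive multiple of the squared norm, on `V` a negative one, and
    -- `B` vanishes on both. Hence the sign of `a` selects the subspace.
    have hP2 : ∀ a b, HasNonneg (realComb A B a b) (U ⊔ V) (k + 1) := by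
      intro a b
      rcases le_total 0 a with ha | ha
      · refine ⟨U, le_sup_left, hUk.ge, fun x hx => ?_⟩
        rw [quadForm_realComb, (hU x hx).2, sub_eq_zero.1 (hU x hx).1]
        simp only [mul_zero, add_zero]
        positivity
      · refine ⟨V, le_sup_right, hVk.ge, fun x hx => ?_⟩
        have h1 : quadForm A x = -(t * ‖x‖ ^ 2) := by linarith [(hV x hx).1]
        rw [quadForm_realComb, (hV x hx).2, h1]
        have : 0 ≤ t * ‖x‖ ^ 2 := by positivity
        nlinarith
    refine HasIsotropic.mono (sup_le hUS hVS) ?_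
    by_cases hstrict : ∀ a b : ℝ, (a ≠ 0 ∨ b ≠ 0) → HasPos (realComb A B a b) (U ⊔ V) (k + 1)
    · have hdim : finrank ℂ (U ⊔ V : Submodule ℂ E) ≤ 2 * (k + 1) := by
        have := Submodule.finrank_add_le_finrank_add_finrank U V
        omega
      have hnd : ∀ a b : ℝ, (a ≠ 0 ∨ b ≠ 0) → ∀ x ∈ U ⊔ V,
          (∀ y ∈ U ⊔ V, inner ℂ (realComb A B a b x) y = 0) → x = 0 := by
        intro a b hab x hx hrad
        refine eq_zero_of_mem_radical (hA.realComb hB a b) (hstrict a b hab) ?_ hdim hx hrad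
        have : -realComb A B a b = realComb A B (-a) (-b) := by
          simp [realComb]
          abel
        rw [this]
        exact hstrict _ _ (by simpa using hab)
      have hne : U ⊔ V ≠ ⊥ := by
        intro h
        have := Submodule.finrank_mono (le_sup_left : U ≤ U ⊔ V)
        rw [h, finrank_bot] at this
        omega
      -- If `A` did not vanish at the eigenvector, `μ` would be real and `B - μ A` a degenerate real
      -- combination, contradicting `hnd`. Thus `x` is isotropic for both forms, and dependent.
      obtain ⟨x, hx, hx0, μ, hμ⟩ := exists_pencil_eigenvector A B hne fun x hx hr =>
        hnd 1 0 (by simp) x hx fun y hy => by rw [inner_realComb, hr y hy]; simp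
      have hxx := hμ x hx
      rw [hA.inner_self, hB.inner_self] at hxx
      have hAx : quadForm A x = 0 := by
        by_contra hAx
        have hreal : μ = ((quadForm B x / quadForm A x : ℝ) : ℂ) := by
          have : (quadForm A x : ℂ) ≠ 0 := by exact_mod_cast hAx
          push_cast
          rw [hxx]
          field_simp
        refine hx0 (hnd (-(quadForm B x / quadForm A x)) 1 (by simp) x hx fun y hy => ?_)
        rw [inner_realComb, hμ y hy, hreal]
        push_cast
        ring
      have hBx : quadForm B x = 0 := by
        rw [hAx, Complex.ofReal_zero, mul_zero] at hxx
        exact_mod_cast hxx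
      exact hasIsotropic_succ_of_dependent hA hB (fun S' h => IH hA hB h) hP2 hx hx0 hAx hBx
        (α := -μ) (β := 1) (by simp) fun y hy => by rw [hμ y hy]; ring
    · push Not at hstrict
      obtain ⟨a, b, hab, hns⟩ := hstrict
      exact hasIsotropic_succ_of_not_hasPos hA hB (fun S' h => IH hA hB h) hP2 hab hns

end HigherRankNumericalRange

/-! ### Nonempty joint rank-k numerical range via Helly's theorem -/

section HigherRankNonempty

variable {E : Type*} [NormedAddCommGroup E] [InnerProductSpace ℂ E] [FiniteDimensional ℂ E]

/-- A subspace of codimension less than `k` on which `H` stays below its `k`-th largest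
eigenvalue. -/
theorem exists_subspace_hasNonneg_shiftOp {H : E →L[ℂ] E} (hH : IsHermitianOp H) {k : ℕ}
    (hk : 0 < k) (hkE : k ≤ finrank ℂ E) :
    ∃ V : Submodule ℂ E, finrank ℂ E + 1 ≤ finrank ℂ V + k ∧
      ∀ x ∈ V, ‖x‖ = 1 → HasNonneg (shiftOp H (quadForm H x)) ⊤ k := by
  let T : Set ℝ := {s | HasNonneg (shiftOp H s) ⊤ k}
  have hcont : Continuous (shiftOp H) := by
    unfold shiftOp
    fun_prop
  have hne : T.Nonempty := by
    refine ⟨-‖H‖, ⊤, le_rfl, by simpa using hkE, fun x _ => ?_⟩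
    rw [quadForm_shiftOp]
    linarith [neg_le_of_abs_le (abs_quadForm_le H x)]
  have hbdd : BddAbove T := by
    refine ⟨‖H‖, fun s hs => ?_⟩
    obtain ⟨W, -, hk', hW⟩ := hs
    have hne : W ≠ ⊥ := by
      rintro rfl
      rw [finrank_bot] at hk'
      omega
    obtain ⟨x, hxW, hx0⟩ := Submodule.exists_mem_ne_zero_of_ne_bot hne
    have h1 := hW x hxW
    rw [quadForm_shiftOp] at h1
    have h2 := (le_abs_self _).trans (abs_quadForm_le H x)
    have h3 : 0 < ‖x‖ ^ 2 := by positivity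
    by_contra! h4
    nlinarith
  have hclosed : IsClosed T := by
    rw [← isSeqClosed_iff_isClosed]
    exact fun u s hu hlim => hasNonneg_of_tendsto ((hcont.tendsto s).comp hlim) hu
  have hsT : sSup T ∈ T := hclosed.csSup_mem hne hbdd
  -- By min-max, `s` is the `k`-th largest eigenvalue of `H`; strict positivity of `H - s` in
  -- dimension `k` fails, for otherwise `s` could be increased.
  set s := sSup T with hs
  have hns : ¬ HasPos (shiftOp H s) ⊤ k := by
    intro h
    obtain ⟨ε, hε, hball⟩ := h.exists_hasNonneg_of_norm_sub_lt
    have h0 := (tendsto_one_div_add_atTop_nhds_zero_nat (𝕜 := ℝ)).const_add s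
    rw [add_zero] at h0
    obtain ⟨m, hm⟩ := (Metric.tendsto_nhds.1 ((hcont.tendsto s).comp h0) ε hε).exists
    rw [dist_eq_norm] at hm
    have h1 := le_csSup hbdd (hball _ hm : s + 1 / ((m : ℝ) + 1) ∈ T)
    have h2 : 0 < 1 / ((m : ℝ) + 1) := by positivity
    linarith
  obtain ⟨P, hPS, N, -, hP, hN, hdim, -⟩ := exists_splitting (hH.shiftOp s) ⊤
  have hPk : finrank ℂ P < k := by
    by_contra! h
    exact hns ⟨P, hPS, h, hP⟩
  rw [finrank_top] at hdim
  refine ⟨N, by omega, fun x hx hx1 => ?_⟩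
  have hxs := hN x hx
  rw [quadForm_shiftOp, hx1] at hxs
  obtain ⟨W, hWS, hWk, hW⟩ := hsT
  refine ⟨W, hWS, hWk, fun y hy => ?_⟩
  have h1 := hW y hy
  rw [quadForm_shiftOp] at h1 ⊢
  nlinarith [sq_nonneg ‖y‖]

theorem finrank_le_finrank_biInf_add {ι K V : Type*} [Field K] [AddCommGroup V] [Module K V]
    [FiniteDimensional K V] (W : ι → Submodule K V) {c : ℕ}
    (hW : ∀ i, finrank K V ≤ finrank K (W i) + c) (I : Finset ι) :
    finrank K V ≤ finrank K (⨅ i ∈ I, W i : Submodule K V) + I.card * c := by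
  classical
  induction I using Finset.induction_on with
  | empty =>
    have : (⨅ i ∈ (∅ : Finset ι), W i) = ⊤ := by simp
    rw [this, finrank_top]
    exact Nat.le_add_right _ _
  | insert i I hi ih =>
    rw [Finset.iInf_insert, Finset.card_insert_of_notMem hi, add_mul, one_mul]
    have h1 := Submodule.finrank_sup_add_finrank_inf_eq (W i) (⨅ j ∈ I, W j)
    have h2 := Submodule.finrank_le (W i ⊔ ⨅ j ∈ I, W j)
    have h3 := hW i
    omega

/-- For each direction `u` the admissible points `(s, t)` satisfy a linear inequality: `u · (s, t)`
is at most the `k`-th largest eigenvalue of the combination. Helly reduces a common point to three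
directions at a time, where the values of the two forms at a suitable unit vector work. -/
theorem exists_forall_hasNonneg_shiftOp {A B : E →L[ℂ] E} (hA : IsHermitianOp A)
    (hB : IsHermitianOp B) {k : ℕ} (hk : 0 < k) (hkE : 3 * k - 2 ≤ finrank ℂ E) :
    ∃ s t : ℝ, ∀ a b, HasNonneg (realComb (shiftOp A s) (shiftOp B t) a b) ⊤ k := by
  -- The ball only makes the sets compact, as Helly for an infinite family requires; its radius
  -- bounds the values of both forms at unit vectors.
  let F : ℝ × ℝ → Set (ℝ × ℝ) := fun u => Metric.closedBall 0 (‖A‖ + ‖B‖) ∩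
    {p | HasNonneg (shiftOp (realComb A B u.1 u.2) (u.1 * p.1 + u.2 * p.2)) ⊤ k}
  have hconv : ∀ u, Convex ℝ (F u) := by
    intro u
    refine (convex_closedBall _ _).inter ?_
    rintro p ⟨W, hW, hWk, hWp⟩ q ⟨W', hW', hWk', hWq⟩ c d hc hd hcd
    simp only [Set.mem_ofPred_eq, Prod.fst_add, Prod.snd_add, Prod.smul_fst, Prod.smul_snd,
      smul_eq_mul]
    rcases le_total (u.1 * p.1 + u.2 * p.2) (u.1 * q.1 + u.2 * q.2) with h | h
    · refine ⟨W', hW', hWk', fun x hx => ?_⟩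
      have h1 := hWq x hx
      rw [quadForm_shiftOp] at h1 ⊢
      have h2 : u.1 * (c * p.1 + d * q.1) + u.2 * (c * p.2 + d * q.2) ≤
          u.1 * q.1 + u.2 * q.2 := by
        have : c = 1 - d := by linarith
        subst this
        nlinarith
      nlinarith [sq_nonneg ‖x‖]
    · refine ⟨W, hW, hWk, fun x hx => ?_⟩
      have h1 := hWp x hx
      rw [quadForm_shiftOp] at h1 ⊢
      have h2 : u.1 * (c * p.1 + d * q.1) + u.2 * (c * p.2 + d * q.2) ≤
          u.1 * p.1 + u.2 * p.2 := by
        have : d = 1 - c := by linarith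
        subst this
        nlinarith
      nlinarith [sq_nonneg ‖x‖]
  have hcpt : ∀ u, IsCompact (F u) := by
    intro u
    refine (isCompact_closedBall _ _).inter_right ?_
    rw [← isSeqClosed_iff_isClosed]
    intro v p hv hlim
    have hcont : Continuous fun p : ℝ × ℝ =>
        shiftOp (realComb A B u.1 u.2) (u.1 * p.1 + u.2 * p.2) := by
      unfold shiftOp
      fun_prop
    exact hasNonneg_of_tendsto ((hcont.tendsto p).comp hlim) hv
  choose V hVdim hV using fun u : ℝ × ℝ =>
    exists_subspace_hasNonneg_shiftOp (hA.realComb hB u.1 u.2) hk (by omega)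
  obtain ⟨p, hp⟩ := Convex.helly_theorem_compact' (𝕜 := ℝ) hconv hcpt fun I hI => by
    rw [finrank_prod, finrank_self] at hI
    have hdim := finrank_le_finrank_biInf_add V (c := k - 1)
      (fun u => by have := hVdim u; omega) I
    -- At most three subspaces of codimension at most `k - 1` are intersected, and `3 (k - 1) < 3 k
    -- - 2`: this is where the Ramsey number comes from.
    have hne : (⨅ u ∈ I, V u) ≠ ⊥ := by
      intro h
      rw [h, finrank_bot] at hdim
      have := Nat.mul_le_mul_right (k - 1) hI
      omega
    obtain ⟨x, hx, hx0⟩ := Submodule.exists_mem_ne_zero_of_ne_bot hne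
    set y := (‖x‖ : ℂ)⁻¹ • x with hy
    have hyV : y ∈ ⨅ u ∈ I, V u := Submodule.smul_mem _ _ hx
    have hy1 : ‖y‖ = 1 := by simp [hy, norm_smul, hx0]
    refine ⟨(quadForm A y, quadForm B y), Set.mem_iInter₂.2 fun u hu => ⟨?_, ?_⟩⟩
    · have h1 := abs_quadForm_le A y
      have h2 := abs_quadForm_le B y
      rw [hy1, one_pow, mul_one] at h1 h2
      rw [mem_closedBall_zero_iff, Prod.norm_def, max_le_iff, Real.norm_eq_abs, Real.norm_eq_abs]
      constructor
      · linarith [norm_nonneg B]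
      · linarith [norm_nonneg A]
    · have := hV u y ((iInf₂_le u hu : ⨅ u ∈ I, V u ≤ V u) hyV) hy1
      rwa [quadForm_realComb] at this
  refine ⟨p.1, p.2, fun a b => ?_⟩
  refine (Set.mem_iInter.1 hp (a, b)).2.of_forall_quadForm_eq one_pos fun x => ?_
  rw [quadForm_shiftOp, quadForm_realComb, quadForm_realComb, quadForm_shiftOp, quadForm_shiftOp]
  ring

/-- The joint rank-`k` numerical range of two Hermitian operators is nonempty in dimension at
least `3 k - 2`. -/
theorem exists_scalar_subspace {A B : E →L[ℂ] E} (hA : IsHermitianOp A)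
    (hB : IsHermitianOp B) {k : ℕ} (hk : 0 < k) (hkE : 3 * k - 2 ≤ finrank ℂ E) :
    ∃ s t : ℝ, ∃ Z : Submodule ℂ E, finrank ℂ Z = k ∧
      ∀ x ∈ Z, quadForm A x = s * ‖x‖ ^ 2 ∧ quadForm B x = t * ‖x‖ ^ 2 := by
  obtain ⟨s, t, h⟩ := exists_forall_hasNonneg_shiftOp hA hB hk hkE
  obtain ⟨Z, -, hZk, hZ⟩ := hasIsotropic_of_forall_hasNonneg k (hA.shiftOp s) (hB.shiftOp t) h
  refine ⟨s, t, Z, hZk, fun x hx => ?_⟩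
  have := hZ x hx
  rwa [quadForm_shiftOp, quadForm_shiftOp, sub_eq_zero, sub_eq_zero] at this

end HigherRankNonempty

/-! ### From frames to projections; anticliques in dimension at most three -/

section Matrices

open Matrix

variable {n k : ℕ}

/-- The orthogonal projection onto the column space of `U`. -/
noncomputable def columnProjection (U : Matrix (Fin n) (Fin k) ℂ) : Matrix (Fin n) (Fin n) ℂ :=
  U * (Uᴴ * U)⁻¹ * Uᴴ

theorem columnProjection_mul_self {U : Matrix (Fin n) (Fin k) ℂ} (hU : IsUnit (Uᴴ * U).det) :
    columnProjection U * U = U := by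
  rw [columnProjection, Matrix.mul_assoc, Matrix.mul_assoc, Matrix.nonsing_inv_mul _ hU,
    Matrix.mul_one]

theorem isStarProjection_columnProjection {U : Matrix (Fin n) (Fin k) ℂ}
    (hU : IsUnit (Uᴴ * U).det) : IsStarProjection (columnProjection U) := by
  constructor
  · change columnProjection U * columnProjection U = columnProjection U
    conv_lhs => rw [columnProjection.eq_1 U]
    rw [columnProjection, ← Matrix.mul_assoc, ← Matrix.mul_assoc]
    have := columnProjection_mul_self hU
    rw [columnProjection] at this
    rw [this]
  · change (columnProjection U)ᴴ = columnProjection U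
    rw [columnProjection, conjTranspose_mul, conjTranspose_mul, conjTranspose_nonsing_inv,
      conjTranspose_mul, conjTranspose_conjTranspose, Matrix.mul_assoc]

open scoped ComplexOrder in
theorem rank_columnProjection {U : Matrix (Fin n) (Fin k) ℂ}
    (hU : IsUnit (Uᴴ * U).det) : (columnProjection U).rank = k := by
  have hUk : U.rank = k := by
    rw [← rank_conjTranspose_mul_self, rank_of_isUnit _ ((isUnit_iff_isUnit_det _).2 hU),
      Fintype.card_fin]
  apply le_antisymm
  · refine (rank_mul_le_left _ _).trans ((rank_mul_le_left _ _).trans hUk.le)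
  · have := rank_mul_le_left (columnProjection U) U
    rwa [columnProjection_mul_self hU, hUk] at this

/-- `P A P` depends on `A` only through `Uᴴ A U`, so cliques and anticliques can be tested on any
frame with invertible Gram matrix. Not requiring orthonormality leaves room for perturbing `U`
linearly. -/
theorem columnProjection_compress (U : Matrix (Fin n) (Fin k) ℂ) (A : Matrix (Fin n) (Fin n) ℂ) :
    columnProjection U * A * columnProjection U =
      U * (Uᴴ * U)⁻¹ * (Uᴴ * A * U) * ((Uᴴ * U)⁻¹ * Uᴴ) := by
  simp only [columnProjection, Matrix.mul_assoc]

theorem hasClique_of_compress_surjective {V : Submodule ℂ (Matrix (Fin n) (Fin n) ℂ)}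
    {U : Matrix (Fin n) (Fin k) ℂ} (hU : IsUnit (Uᴴ * U).det)
    (h : ∀ Y, ∃ A ∈ V, Uᴴ * A * U = Y) : HasClique V k := by
  refine ⟨columnProjection U, isStarProjection_columnProjection hU, rank_columnProjection hU,
    le_antisymm (Submodule.map_mono le_top) fun B hB => ?_⟩
  obtain ⟨A, -, rfl⟩ := mem_compression.1 hB
  obtain ⟨A', hA', heq⟩ := h (Uᴴ * A * U)
  exact mem_compression.2 ⟨A', hA', by
    rw [columnProjection_compress, columnProjection_compress, heq]⟩

theorem hasAnticlique_of_compress_scalar {V : Submodule ℂ (Matrix (Fin n) (Fin n) ℂ)}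
    (hV : IsOperatorSystem V) {U : Matrix (Fin n) (Fin k) ℂ} (hU : IsUnit (Uᴴ * U).det)
    (h : ∀ A ∈ V, ∃ c : ℂ, Uᴴ * A * U = c • (Uᴴ * U)) : HasAnticlique V k := by
  refine ⟨columnProjection U, isStarProjection_columnProjection hU, rank_columnProjection hU,
    le_antisymm (fun B hB => ?_) ?_⟩
  · obtain ⟨A, hA, rfl⟩ := mem_compression.1 hB
    obtain ⟨c, hc⟩ := h A hA
    refine Submodule.mem_span_singleton.2 ⟨c, ?_⟩
    rw [columnProjection_compress, hc, Matrix.mul_smul, Matrix.smul_mul, Matrix.mul_assoc U,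
      Matrix.nonsing_inv_mul _ hU, Matrix.mul_one, columnProjection, Matrix.mul_assoc]
  · rw [Submodule.span_singleton_le_iff_mem]
    exact mem_compression.2 ⟨1, hV.one_mem, by
      rw [Matrix.mul_one]; exact (isStarProjection_columnProjection hU).isIdempotentElem⟩

/-- A `*`-closed subspace is determined by its Hermitian elements. -/
theorem exists_isHermitian_notMem {ι : Type*} {V W : Submodule ℂ (Matrix ι ι ℂ)}
    (hV : ∀ A ∈ V, Aᴴ ∈ V) (h : ¬ V ≤ W) : ∃ A ∈ V, A.IsHermitian ∧ A ∉ W := by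
  by_contra! hc
  refine h fun X hX => ?_
  have h1 : X + Xᴴ ∈ W := hc _ (V.add_mem hX (hV X hX)) (isHermitian_add_transpose_self X)
  have h2 : Complex.I • (X - Xᴴ) ∈ W := by
    refine hc _ (V.smul_mem _ (V.sub_mem hX (hV X hX))) ?_
    rw [IsHermitian, conjTranspose_smul, conjTranspose_sub, conjTranspose_conjTranspose]
    simp only [Complex.star_def, Complex.conj_I, neg_smul, ← smul_neg, neg_sub]
  have h3 : X = (1 / 2 : ℂ) • (X + Xᴴ) + (-Complex.I / 2) • (Complex.I • (X - Xᴴ)) := by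
    rw [smul_smul]
    have : -Complex.I / 2 * Complex.I = 1 / 2 := by
      rw [div_mul_eq_mul_div, neg_mul, Complex.I_mul_I, neg_neg]
    rw [this, ← smul_add, add_add_sub_cancel, ← two_smul ℂ X, smul_smul]
    norm_num
  rw [h3]
  exact W.add_mem (W.smul_mem _ h1) (W.smul_mem _ h2)

theorem finrank_sup_span_singleton_add_one_le {K M : Type*} [Field K] [AddCommGroup M] [Module K M]
    [FiniteDimensional K M] {W : Submodule K M} {A : M} (hA : A ∉ W) :
    finrank K W + 1 ≤ finrank K (W ⊔ Submodule.span K {A} : Submodule K M) := by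
  refine Submodule.finrank_lt_finrank_of_lt (lt_of_le_of_ne le_sup_left fun h => hA ?_)
  rw [h]
  exact Submodule.mem_sup_right (Submodule.mem_span_singleton_self A)

/-- An operator system of dimension at most three is spanned by the identity and two Hermitian
matrices. -/
theorem exists_isHermitian_span {V : Submodule ℂ (Matrix (Fin n) (Fin n) ℂ)}
    (hV : IsOperatorSystem V) (hn : 0 < n) (h3 : finrank ℂ V ≤ 3) :
    ∃ A B : Matrix (Fin n) (Fin n) ℂ, A.IsHermitian ∧ B.IsHermitian ∧
      V ≤ Submodule.span ℂ {1} ⊔ Submodule.span ℂ {A} ⊔ Submodule.span ℂ {B} := by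
  have : Nonempty (Fin n) := ⟨⟨0, hn⟩⟩
  have hle : Submodule.span ℂ {(1 : Matrix (Fin n) (Fin n) ℂ)} ≤ V :=
    (Submodule.span_singleton_le_iff_mem _ _).2 hV.one_mem
  have h1 : finrank ℂ (Submodule.span ℂ {(1 : Matrix (Fin n) (Fin n) ℂ)}) = 1 :=
    finrank_span_singleton one_ne_zero
  by_cases hV1 : V ≤ Submodule.span ℂ {1}
  · exact ⟨0, 0, isHermitian_zero, isHermitian_zero, hV1.trans (le_sup_left.trans le_sup_left)⟩
  obtain ⟨A, hAV, hA, hA1⟩ := exists_isHermitian_notMem hV.conjTranspose_mem hV1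
  have h2 := finrank_sup_span_singleton_add_one_le hA1
  have hleA := sup_le hle ((Submodule.span_singleton_le_iff_mem A V).2 hAV)
  by_cases hV2 : V ≤ Submodule.span ℂ {1} ⊔ Submodule.span ℂ {A}
  · exact ⟨A, 0, hA, isHermitian_zero, hV2.trans le_sup_left⟩
  obtain ⟨B, hBV, hB, hB1⟩ := exists_isHermitian_notMem hV.conjTranspose_mem hV2
  have h4 := finrank_sup_span_singleton_add_one_le hB1
  refine ⟨A, B, hA, hB, (Submodule.eq_of_le_of_finrank_le
    (sup_le hleA ((Submodule.span_singleton_le_iff_mem B V).2 hBV)) (by omega)).ge⟩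

theorem isHermitianOp_toEuclideanCLM {A : Matrix (Fin n) (Fin n) ℂ} (hA : A.IsHermitian) :
    IsHermitianOp (toEuclideanCLM (𝕜 := ℂ) A) := by
  intro x y
  exact isSymmetric_toEuclideanLin_iff.2 hA x y

theorem hasAnticlique_of_finrank_le_three {V : Submodule ℂ (Matrix (Fin n) (Fin n) ℂ)}
    (hV : IsOperatorSystem V) (hk : 0 < k) (hn : 3 * k - 2 ≤ n) (h3 : finrank ℂ V ≤ 3) :
    HasAnticlique V k := by
  obtain ⟨A, B, hA, hB, hVAB⟩ := exists_isHermitian_span hV (by omega) h3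
  obtain ⟨s, t, Z, hZk, hZ⟩ := exists_scalar_subspace (isHermitianOp_toEuclideanCLM hA)
    (isHermitianOp_toEuclideanCLM hB) hk (by simpa using hn)
  let b := (stdOrthonormalBasis ℂ Z).reindex (finCongr hZk)
  let U : Matrix (Fin n) (Fin k) ℂ := Matrix.of fun i j => (b j : EuclideanSpace ℂ (Fin n)) i
  have hentry : ∀ (M : Matrix (Fin n) (Fin n) ℂ) (i j : Fin k), (Uᴴ * M * U) i j =
      inner ℂ (b i : EuclideanSpace ℂ (Fin n)) (toEuclideanCLM (𝕜 := ℂ) M (b j)) := by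
    intro M i j
    rw [EuclideanSpace.inner_eq_star_dotProduct, Matrix.mul_assoc, Matrix.mul_apply]
    simp only [dotProduct, ofLp_toEuclideanCLM, Matrix.mul_apply, mulVec, conjTranspose_apply, U,
      Matrix.of_apply, Pi.star_apply]
    exact Finset.sum_congr rfl fun _ _ => mul_comm _ _
  have hone : Uᴴ * U = 1 := by
    ext i j
    have := hentry 1 i j
    rw [Matrix.mul_one] at this
    rw [this, map_one, one_apply_eq_self, ← Submodule.coe_inner,
      orthonormal_iff_ite.1 b.orthonormal, Matrix.one_apply]
  -- The form of `M - c` vanishes on `Z`, in particular is semidefinite there, so Cauchy–Schwarz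
  -- also kills its off-diagonal entries.
  have hscalar : ∀ (M : Matrix (Fin n) (Fin n) ℂ) (c : ℝ), M.IsHermitian →
      (∀ x ∈ Z, quadForm (toEuclideanCLM (𝕜 := ℂ) M) x = c * ‖x‖ ^ 2) →
      Uᴴ * M * U = (c : ℂ) • (Uᴴ * U) := by
    intro M c hM hq
    ext i j
    have hH := (isHermitianOp_toEuclideanCLM hM).shiftOp c
    have h0 : ∀ x ∈ Z, quadForm (shiftOp (toEuclideanCLM (𝕜 := ℂ) M) c) x = 0 := fun x hx => by
      rw [quadForm_shiftOp, hq x hx, sub_self]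
    have h1 := inner_eq_zero_of_quadForm_nonneg hH (fun x hx => (h0 x hx).ge) (b i).2 (b j).2
      (h0 _ (b i).2)
    rw [hH, shiftOp, _root_.sub_apply, inner_sub_right, sub_eq_zero] at h1
    rw [hentry, h1, Matrix.smul_apply, ← Matrix.mul_one Uᴴ, hentry, map_one]
    exact inner_smul_right _ _ _
  have hUA := hscalar A s hA fun x hx => (hZ x hx).1
  have hUB := hscalar B t hB fun x hx => (hZ x hx).2
  refine hasAnticlique_of_compress_scalar hV (U := U) (by rw [hone]; simp) fun X hX => ?_
  obtain ⟨Y, hY, X3, hX3, rfl⟩ := Submodule.mem_sup.1 (hVAB hX)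
  obtain ⟨X1, hX1, X2, hX2, rfl⟩ := Submodule.mem_sup.1 hY
  obtain ⟨c1, rfl⟩ := Submodule.mem_span_singleton.1 hX1
  obtain ⟨c2, rfl⟩ := Submodule.mem_span_singleton.1 hX2
  obtain ⟨c3, rfl⟩ := Submodule.mem_span_singleton.1 hX3
  refine ⟨c1 + c2 * s + c3 * t, ?_⟩
  simp only [Matrix.mul_add, Matrix.add_mul, Matrix.mul_smul, Matrix.smul_mul, Matrix.mul_one,
    hUA, hUB, smul_smul, add_smul]

end Matrices

/-! ### 2-cliques in dimension at least four -/

section TwoCliques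

open Matrix

theorem exists_trace_mul_eq_zero {m : Type*} [Fintype m] [DecidableEq m]
    {W : Submodule ℂ (Matrix m m ℂ)} (hW : W < ⊤) :
    ∃ F : Matrix m m ℂ, F ≠ 0 ∧ ∀ Y ∈ W, (F * Y).trace = 0 := by
  obtain ⟨f, hf0, hf⟩ := Submodule.exists_le_ker_of_lt_top W hW
  let F : Matrix m m ℂ := Matrix.of fun j i => f (Matrix.single i j 1)
  have hF : ∀ Y, (F * Y).trace = f Y := by
    intro Y
    conv_rhs => rw [matrix_eq_sum_single Y]
    simp only [map_sum, Matrix.trace, Matrix.diag_apply, Matrix.mul_apply]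
    rw [Finset.sum_comm]
    refine Finset.sum_congr rfl fun i _ => Finset.sum_congr rfl fun j _ => ?_
    have : Matrix.single i j (Y i j) = Y i j • Matrix.single i j (1 : ℂ) := by
      rw [Matrix.smul_single, smul_eq_mul, mul_one]
    rw [this, map_smul, smul_eq_mul, mul_comm]
    rfl
  refine ⟨F, fun h => hf0 (LinearMap.ext fun Y => ?_), fun Y hY => ?_⟩
  · rw [← hF, h, Matrix.zero_mul, trace_zero, LinearMap.zero_apply]
  · rw [hF]
    exact hf hY

/-- A proper `*`-closed subspace of matrices is annihilated by a nonzero Hermitian matrix. -/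
theorem exists_isHermitian_trace_mul_eq_zero {m : Type*} [Fintype m] [DecidableEq m]
    {W : Submodule ℂ (Matrix m m ℂ)} (hW : W < ⊤) (hstar : ∀ Y ∈ W, Yᴴ ∈ W) :
    ∃ F : Matrix m m ℂ, F.IsHermitian ∧ F ≠ 0 ∧ ∀ Y ∈ W, (F * Y).trace = 0 := by
  obtain ⟨F₀, hF₀, hF₀W⟩ := exists_trace_mul_eq_zero hW
  let K : Submodule ℂ (Matrix m m ℂ) :=
    { carrier := {F | ∀ Y ∈ W, (F * Y).trace = 0}
      add_mem' := fun {F G} hF hG Y hY => by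
        rw [Matrix.add_mul, trace_add, hF Y hY, hG Y hY, add_zero]
      zero_mem' := fun Y _ => by rw [Matrix.zero_mul, trace_zero]
      smul_mem' := fun c F hF Y hY => by rw [Matrix.smul_mul, trace_smul, hF Y hY, smul_zero] }
  obtain ⟨F, hFK, hF, hF0⟩ := exists_isHermitian_notMem (V := K) (W := ⊥) (fun F hF Y hY => by
    have := hF _ (hstar Y hY)
    rw [← conjTranspose_conjTranspose F, ← conjTranspose_mul, trace_conjTranspose,
      star_eq_zero, trace_mul_comm] at this
    exact this) fun h => hF₀ ((Submodule.mem_bot ℂ).1 (h hF₀W))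
  exact ⟨F, hF, by simpa using hF0, hFK⟩

open scoped ComplexOrder in
/-- A nonzero Hermitian `2 × 2` matrix that is trace-orthogonal to a nonsingular Gram matrix is
nonsingular. -/
theorem isUnit_det_of_trace_mul_gram_eq_zero {n : ℕ} {U : Matrix (Fin n) (Fin 2) ℂ}
    (hU : IsUnit (Uᴴ * U).det) {F : Matrix (Fin 2) (Fin 2) ℂ} (hF : F.IsHermitian) (hF0 : F ≠ 0)
    (htr : (F * (Uᴴ * U)).trace = 0) : IsUnit F.det := by
  by_contra hdet
  have hdet : F.det = 0 := by simpa using hdet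
  -- Cayley–Hamilton for a singular `2 × 2` matrix. It turns the trace of `(U F)ᴴ (U F)` into a
  -- multiple of the vanishing trace `htr`.
  have hsq : F * F = F.trace • F := by
    rw [det_fin_two] at hdet
    ext i j
    fin_cases i <;> fin_cases j <;>
      simp [Matrix.mul_apply, Fin.sum_univ_two, trace_fin_two] <;>
      first | linear_combination -hdet | ring
  have h1 : ((U * F)ᴴ * (U * F)).trace = 0 := by
    rw [conjTranspose_mul, hF.eq, Matrix.mul_assoc, ← Matrix.mul_assoc Uᴴ, ← Matrix.mul_assoc,
      trace_mul_comm, ← Matrix.mul_assoc, hsq, Matrix.smul_mul, trace_smul, htr, smul_zero]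
  have h2 := trace_conjTranspose_mul_self_eq_zero_iff.1 h1
  apply hF0
  rw [← Matrix.one_mul F, ← Matrix.nonsing_inv_mul _ hU, Matrix.mul_assoc, Matrix.mul_assoc, h2,
    Matrix.mul_zero, Matrix.mul_zero]

/-- At a local maximum of the rank, limits of vectors in nearby images lie in the image. -/
theorem mem_map_of_tendsto {M N : Type*} [AddCommGroup M] [Module ℂ M] [NormedAddCommGroup N]
    [NormedSpace ℂ N] [FiniteDimensional ℂ N] (V : Submodule ℂ M) {T : ℕ → M →ₗ[ℂ] N}
    {T₀ : M →ₗ[ℂ] N}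
    (hT : ∀ x ∈ V, Filter.Tendsto (fun m => T m x) Filter.atTop (nhds (T₀ x)))
    (hr : ∀ᶠ m in Filter.atTop, finrank ℂ (V.map (T m)) ≤ finrank ℂ (V.map T₀))
    {y : ℕ → N} {y₀ : N} (hy : ∀ m, y m ∈ V.map (T m))
    (hlim : Filter.Tendsto y Filter.atTop (nhds y₀)) : y₀ ∈ V.map T₀ := by
  by_contra hy₀
  let b := finBasis ℂ (V.map T₀)
  choose x hxV hx using fun i => Submodule.mem_map.1 (b i).2
  have hli : LinearIndependent ℂ (Fin.cons y₀ fun i => (b i : N) : Fin (_ + 1) → N) := by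
    refine linearIndependent_finCons.2
      ⟨b.linearIndependent.map' (Submodule.subtype _) (Submodule.ker_subtype _), fun h => hy₀ ?_⟩
    exact (Submodule.span_le.2 (by rintro _ ⟨i, rfl⟩; exact (b i).2)) h
  have htend : Filter.Tendsto (fun m => (Fin.cons (y m) fun i => T m (x i) : Fin (_ + 1) → N))
      Filter.atTop (nhds (Fin.cons y₀ fun i => (b i : N))) := by
    refine tendsto_pi_nhds.2 fun i => Fin.cases (by simpa using hlim) (fun i => ?_) i
    simpa [hx] using hT (x i) (hxV i)
  -- Linear independence is an open condition, so if `y₀` lay outside the image, a nearby image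
  -- would contain one independent vector too many.
  obtain ⟨m, hm, hmr⟩ := ((htend.eventually hli.eventually).and hr).exists
  have h1 := finrank_span_eq_card hm
  have h2 : Submodule.span ℂ (Set.range (Fin.cons (y m) fun i => T m (x i) : Fin (_ + 1) → N)) ≤
      V.map (T m) := by
    refine Submodule.span_le.2 ?_
    rintro _ ⟨i, rfl⟩
    refine Fin.cases (by simpa using hy m) (fun i => ?_) i
    exact Submodule.mem_map_of_mem (f := T m) (hxV i)
  have h3 := Submodule.finrank_mono h2
  rw [h1, Fintype.card_fin] at h3
  omega

variable {n : ℕ}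

/-- The compression `X ↦ Uᴴ X U`. -/
noncomputable def compress {k : ℕ} (U : Matrix (Fin n) (Fin k) ℂ) :
    Matrix (Fin n) (Fin n) ℂ →ₗ[ℂ] Matrix (Fin k) (Fin k) ℂ where
  toFun X := Uᴴ * X * U
  map_add' X Y := by rw [Matrix.mul_add, Matrix.add_mul]
  map_smul' c X := by rw [Matrix.mul_smul, Matrix.smul_mul, RingHom.id_apply]

theorem compress_apply {k : ℕ} (U : Matrix (Fin n) (Fin k) ℂ) (X : Matrix (Fin n) (Fin n) ℂ) :
    compress U X = Uᴴ * X * U := rfl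

theorem compress_add_smul {k : ℕ} (U D : Matrix (Fin n) (Fin k) ℂ)
    (X : Matrix (Fin n) (Fin n) ℂ) (t : ℝ) :
    compress (U + (t : ℂ) • D) X = compress U X + (t : ℂ) • (Dᴴ * X * U + Uᴴ * X * D) +
      ((t : ℂ) ^ 2) • compress D X := by
  simp only [compress_apply, conjTranspose_add, conjTranspose_smul, Complex.star_def,
    Complex.conj_ofReal, Matrix.add_mul, Matrix.mul_add, Matrix.smul_mul, Matrix.mul_smul,
    smul_add, smul_smul, sq]
  abel

attribute [local instance] Matrix.normedAddCommGroup Matrix.normedSpace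

/-- First and second order information at a frame `U` of maximal compression rank. -/
theorem mem_map_compress_of_maximal {k : ℕ} (V : Submodule ℂ (Matrix (Fin n) (Fin n) ℂ))
    {U : Matrix (Fin n) (Fin k) ℂ} (hU : IsUnit (Uᴴ * U).det)
    (hmax : ∀ U' : Matrix (Fin n) (Fin k) ℂ, IsUnit (U'ᴴ * U').det →
      finrank ℂ (V.map (compress U')) ≤ finrank ℂ (V.map (compress U)))
    (D : Matrix (Fin n) (Fin k) ℂ) {X : Matrix (Fin n) (Fin n) ℂ} (hX : X ∈ V)
    (h0 : compress U X = 0) :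
    Dᴴ * X * U + Uᴴ * X * D ∈ V.map (compress U) ∧
      (Dᴴ * X * U + Uᴴ * X * D = 0 → compress D X ∈ V.map (compress U)) := by
  let t : ℕ → ℝ := fun m => 1 / ((m : ℝ) + 1)
  have ht : Filter.Tendsto t Filter.atTop (nhds 0) := tendsto_one_div_add_atTop_nhds_zero_nat
  have htc : Filter.Tendsto (fun m => (t m : ℂ)) Filter.atTop (nhds 0) := by
    have := (Complex.continuous_ofReal.tendsto 0).comp ht
    rwa [Complex.ofReal_zero] at this
  have ht0 : ∀ m, (t m : ℂ) ≠ 0 := fun m => by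
    have : t m ≠ 0 := by positivity
    exact_mod_cast this
  have hT : ∀ Y ∈ V, Filter.Tendsto (fun m => compress (U + (t m : ℂ) • D) Y) Filter.atTop
      (nhds (compress U Y)) := by
    intro Y _
    simp only [compress_add_smul]
    have := ((htc.smul_const (Dᴴ * Y * U + Uᴴ * Y * D)).const_add (compress U Y)).add
      ((htc.pow 2).smul_const (compress D Y))
    rwa [zero_smul, zero_pow two_ne_zero, zero_smul, add_zero, add_zero] at this
  have hr : ∀ᶠ m in Filter.atTop, finrank ℂ (V.map (compress (U + (t m : ℂ) • D))) ≤
      finrank ℂ (V.map (compress U)) := by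
    have hdet : Filter.Tendsto (fun m => ((U + (t m : ℂ) • D)ᴴ * (U + (t m : ℂ) • D)).det)
        Filter.atTop (nhds (Uᴴ * U).det) := by
      have hc : Continuous fun z : ℂ => ((U + z • D)ᴴ * (U + z • D)).det := by fun_prop
      have := (hc.tendsto 0).comp htc
      rw [zero_smul, add_zero] at this
      exact this
    filter_upwards [hdet.eventually_ne hU.ne_zero] with m hm
    exact hmax _ hm.isUnit
  have hmem : ∀ m (c : ℂ), c • compress (U + (t m : ℂ) • D) X ∈
      V.map (compress (U + (t m : ℂ) • D)) := fun m c =>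
    Submodule.smul_mem _ _ (Submodule.mem_map_of_mem hX)
  constructor
  -- As the zeroth order term vanishes, dividing the compression along `U + t D` by `t` gives the
  -- first derivative in the limit; below, division by `t ^ 2` leaves exactly the second order term.
  · refine mem_map_of_tendsto V hT hr (fun m => hmem m (t m : ℂ)⁻¹) ?_
    have heq : ∀ m, (t m : ℂ)⁻¹ • compress (U + (t m : ℂ) • D) X =
        (Dᴴ * X * U + Uᴴ * X * D) + (t m : ℂ) • compress D X := by
      intro m
      rw [compress_add_smul, h0, zero_add, smul_add, smul_smul, smul_smul, inv_mul_cancel₀ (ht0 m),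
        one_smul, sq, ← mul_assoc, inv_mul_cancel₀ (ht0 m), one_mul]
    simp only [heq]
    have := (htc.smul_const (compress D X)).const_add (Dᴴ * X * U + Uᴴ * X * D)
    rwa [zero_smul, add_zero] at this
  · intro h1
    refine mem_map_of_tendsto V hT hr (fun m => hmem m ((t m : ℂ) ^ 2)⁻¹) ?_
    have heq : ∀ m, ((t m : ℂ) ^ 2)⁻¹ • compress (U + (t m : ℂ) • D) X = compress D X := by
      intro m
      rw [compress_add_smul, h0, h1, smul_zero, zero_add, zero_add, smul_smul,
        inv_mul_cancel₀ (pow_ne_zero 2 (ht0 m)), one_smul]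
    simp only [heq]
    exact tendsto_const_nhds

/-- The sesquilinear form vanishes if its polarized symmetrization does. -/
theorem trace_polarization {m p : Type*} [Fintype m] [Fintype p] {F : Matrix p p ℂ}
    {X : Matrix m m ℂ} {U : Matrix m p ℂ}
    (h : ∀ D : Matrix m p ℂ, (F * (Dᴴ * X * U + Uᴴ * X * D)).trace = 0) : X * U * F = 0 := by
  have key : ∀ D : Matrix m p ℂ, (F * (Dᴴ * X * U)).trace = 0 := by
    intro D
    have h1 := h D
    -- Replacing `D` by `i D` changes the relative sign of the conjugate-linear and linear parts,
    -- which separates them.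
    have h2 := h (Complex.I • D)
    simp only [conjTranspose_smul, Complex.star_def, Complex.conj_I, Matrix.mul_add,
      Matrix.smul_mul, Matrix.mul_smul, trace_add, trace_smul, smul_eq_mul] at h1 h2
    linear_combination (1 / 2) * h1 + (Complex.I / 2) * h2 -
      (1 / 2) * ((F * (Uᴴ * X * D)).trace - (F * (Dᴴ * X * U)).trace) * Complex.I_mul_I
  refine ext_iff_trace_mul_left.2 fun D => ?_
  rw [Matrix.mul_zero, trace_zero, ← key Dᴴ, conjTranspose_conjTranspose, trace_mul_comm F,
    Matrix.mul_assoc, Matrix.mul_assoc, Matrix.mul_assoc]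

/-- An operator system of dimension at least four has a `2`-clique. -/
theorem hasClique_two_of_four_le_finrank {V : Submodule ℂ (Matrix (Fin n) (Fin n) ℂ)}
    (hV : IsOperatorSystem V) (h4 : 4 ≤ finrank ℂ V) : HasClique V 2 := by
  have hn : 2 ≤ n := by
    have := h4.trans (Submodule.finrank_le V)
    rw [finrank_matrix, finrank_self, mul_one, Fintype.card_fin] at this
    by_contra! h
    interval_cases n <;> omega
  obtain ⟨U₀, hU₀⟩ : ∃ U : Matrix (Fin n) (Fin 2) ℂ, IsUnit (Uᴴ * U).det := by
    refine ⟨(1 : Matrix (Fin n) (Fin n) ℂ).submatrix id (Fin.castLE hn), ?_⟩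
    have : ((1 : Matrix (Fin n) (Fin n) ℂ).submatrix id (Fin.castLE hn))ᴴ *
        (1 : Matrix (Fin n) (Fin n) ℂ).submatrix id (Fin.castLE hn) = 1 := by
      rw [conjTranspose_submatrix, conjTranspose_one, ← submatrix_mul _ _ _ id _ Function.bijective_id,
        Matrix.one_mul, submatrix_one _ (Fin.castLE_injective hn)]
    rw [this]
    simp
  obtain ⟨U, hU, hmax⟩ : ∃ U : Matrix (Fin n) (Fin 2) ℂ, IsUnit (Uᴴ * U).det ∧
      ∀ U' : Matrix (Fin n) (Fin 2) ℂ, IsUnit (U'ᴴ * U').det →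
        finrank ℂ (V.map (compress U')) ≤ finrank ℂ (V.map (compress U)) := by
    -- Ranks are at most `4`, the dimension of the `2 × 2` matrices, so minimizing the truncated
    -- difference maximizes the rank.
    obtain ⟨U, hU, hmin⟩ := WellFounded.has_min
      (measure fun U : Matrix (Fin n) (Fin 2) ℂ => 4 - finrank ℂ (V.map (compress U))).wf
      {U | IsUnit (Uᴴ * U).det} ⟨U₀, hU₀⟩
    refine ⟨U, hU, fun U' hU' => ?_⟩
    have h1 : ¬ (4 - finrank ℂ (V.map (compress U')) < 4 - finrank ℂ (V.map (compress U))) :=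
      hmin U' hU'
    have h2 := Submodule.finrank_le (V.map (compress U'))
    rw [finrank_matrix, finrank_self, Fintype.card_fin] at h2
    omega
  by_cases htop : V.map (compress U) = ⊤
  · refine hasClique_of_compress_surjective hU fun Y => ?_
    have : Y ∈ V.map (compress U) := htop ▸ Submodule.mem_top
    exact this
  exfalso
  have hlt := lt_of_le_of_ne le_top htop
  have hcstar : ∀ X, compress U Xᴴ = (compress U X)ᴴ := fun X => by
    rw [compress_apply, compress_apply, conjTranspose_mul, conjTranspose_mul,
      conjTranspose_conjTranspose, Matrix.mul_assoc]
  obtain ⟨F, hF, hF0, hFW⟩ := exists_isHermitian_trace_mul_eq_zero hlt (by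
    rintro _ ⟨X, hX, rfl⟩
    exact ⟨Xᴴ, hV.conjTranspose_mem X hX, hcstar X⟩)
  have hFdet : IsUnit F.det := by
    refine isUnit_det_of_trace_mul_gram_eq_zero hU hF hF0 ?_
    have := hFW _ (Submodule.mem_map_of_mem hV.one_mem)
    rwa [compress_apply, Matrix.mul_one] at this
  have hcancel : ∀ Y : Matrix (Fin n) (Fin 2) ℂ, Y * F = 0 → Y = 0 := fun Y hY => by
    rw [← Matrix.mul_one Y, ← Matrix.mul_nonsing_inv _ hFdet, ← Matrix.mul_assoc, hY,
      Matrix.zero_mul]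
  -- A proper image has dimension at most three while `V` has dimension at least four, so
  -- compression has a nonzero kernel in `V`; the kernel is `*`-closed.
  obtain ⟨X, ⟨hXV, hXU⟩, hX, hX0⟩ := exists_isHermitian_notMem
    (V := V ⊓ LinearMap.ker (compress U)) (W := ⊥)
    (fun A hA => ⟨hV.conjTranspose_mem A hA.1, by
      change compress U Aᴴ = 0
      rw [hcstar, show compress U A = 0 from hA.2, conjTranspose_zero]⟩) (by
    intro hle
    have hinj : Function.Injective ((compress U).domRestrict V) := by
      rw [← LinearMap.ker_eq_bot, Submodule.eq_bot_iff]
      intro A hA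
      exact Subtype.ext ((Submodule.mem_bot ℂ).1 (hle ⟨A.2, hA⟩))
    have h1 := LinearMap.finrank_range_of_inj hinj
    rw [LinearMap.range_domRestrict] at h1
    have h2 := Submodule.finrank_lt hlt.ne
    rw [finrank_matrix, finrank_self, Fintype.card_fin] at h2
    omega)
  have hXU0 : X * U = 0 := hcancel _ (trace_polarization fun D =>
    hFW _ (mem_map_compress_of_maximal V hU hmax D hXV hXU).1)
  have hUX0 : Uᴴ * X = 0 := by
    rw [← hX.eq, ← conjTranspose_mul, hXU0, conjTranspose_zero]
  -- With `X U = 0` the first order term vanishes for every `D`, so the second order condition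
  -- applies in all directions; its polarization gives `X E = 0` for all `E`.
  have hquad : ∀ D : Matrix (Fin n) (Fin 2) ℂ, (F * (Dᴴ * X * D)).trace = 0 := fun D =>
    hFW _ ((mem_map_compress_of_maximal V hU hmax D hXV hXU).2 (by
      rw [Matrix.mul_assoc, hXU0, hUX0, Matrix.mul_zero, Matrix.zero_mul, add_zero]))
  have hXE : ∀ E : Matrix (Fin n) (Fin 2) ℂ, X * E = 0 := fun E =>
    hcancel _ (trace_polarization fun D => by
      have h1 := hquad (D + E)
      simp only [conjTranspose_add, Matrix.add_mul, Matrix.mul_add, trace_add, hquad D,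
        hquad E] at h1
      rw [Matrix.mul_add, trace_add]
      linear_combination h1)
  refine hX0 ((Submodule.mem_bot ℂ).2 (Matrix.ext fun i j => ?_))
  have := congrFun (congrFun (hXE (Matrix.single j 0 1)) i) 0
  simpa using this

end TwoCliques

/-! ### Sharpness: three complementary diagonal projections -/

section LowerBound

open Matrix

theorem exists_rank_factorization {n : ℕ} {P : Matrix (Fin n) (Fin n) ℂ} (hP : P * P = P) :
    ∃ (B : Matrix (Fin n) (Fin P.rank) ℂ) (C : Matrix (Fin P.rank) (Fin n) ℂ),
      B * C = P ∧ C * B = 1 := by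
  let R := LinearMap.range P.mulVecLin
  let e : Basis (Fin P.rank) ℂ R := finBasis ℂ R
  let b : (Fin P.rank → ℂ) →ₗ[ℂ] (Fin n → ℂ) := R.subtype ∘ₗ e.equivFun.symm.toLinearMap
  let c : (Fin n → ℂ) →ₗ[ℂ] (Fin P.rank → ℂ) :=
    e.equivFun.toLinearMap ∘ₗ P.mulVecLin.rangeRestrict
  have hbc : b ∘ₗ c = P.mulVecLin := by
    refine LinearMap.ext fun x => ?_
    simp [b, c]
  have hcb : c ∘ₗ b = LinearMap.id := by
    refine LinearMap.ext fun x => ?_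
    have hfix : ∀ y : R, P.mulVecLin.rangeRestrict (y : Fin n → ℂ) = y := by
      rintro ⟨_, x, rfl⟩
      refine Subtype.ext ?_
      simp [Matrix.mulVec_mulVec, hP]
    simp only [b, c, LinearMap.comp_apply, Submodule.subtype_apply, LinearEquiv.coe_coe, hfix,
      LinearEquiv.apply_symm_apply, LinearMap.id_apply]
  refine ⟨LinearMap.toMatrix' b, LinearMap.toMatrix' c, ?_, ?_⟩
  · rw [← LinearMap.toMatrix'_comp, hbc]
    exact LinearMap.toMatrix'_toLin' P
  · rw [← LinearMap.toMatrix'_comp, hcb, LinearMap.toMatrix'_id]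

/-- A factorization `P = B C` with `C B = 1` embeds the `j × j` matrices into `P M_n P` by `Y ↦ B Y
C`, and for a clique this space is a linear image of `V`. -/
theorem HasClique.sq_le_finrank {n j : ℕ} {V : Submodule ℂ (Matrix (Fin n) (Fin n) ℂ)}
    (h : HasClique V j) : j ^ 2 ≤ finrank ℂ V := by
  obtain ⟨P, hP, rfl, hPV⟩ := h
  obtain ⟨B, C, hBC, hCB⟩ := exists_rank_factorization (P := P) hP.isIdempotentElem
  have hle : finrank ℂ (compression P V) ≤ finrank ℂ V := Submodule.finrank_map_le _ _
  rw [hPV] at hle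
  let f : Matrix (Fin P.rank) (Fin P.rank) ℂ →ₗ[ℂ] Matrix (Fin n) (Fin n) ℂ :=
    { toFun := fun Y => B * Y * C
      map_add' := fun X Y => by rw [Matrix.mul_add, Matrix.add_mul]
      map_smul' := fun c X => by rw [Matrix.mul_smul, Matrix.smul_mul, RingHom.id_apply] }
  have hcomp : ∀ Y : Matrix (Fin P.rank) (Fin P.rank) ℂ, C * (B * Y * C) * B = Y := fun Y => by
    rw [← Matrix.mul_assoc, ← Matrix.mul_assoc, hCB, Matrix.one_mul, Matrix.mul_assoc, hCB,
      Matrix.mul_one]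
  have hPB : P * B = B :=
    (congrArg (· * B) hBC.symm).trans (by rw [Matrix.mul_assoc, hCB, Matrix.mul_one])
  have hCP : C * P = C :=
    (congrArg (C * ·) hBC.symm).trans (by rw [← Matrix.mul_assoc, hCB, Matrix.one_mul])
  have hinj : Function.Injective f := fun X Y hXY => by
    rw [← hcomp X, ← hcomp Y]
    exact congrArg (fun Z => C * Z * B) hXY
  have hrange : LinearMap.range f ≤ compression P ⊤ := by
    rintro _ ⟨Y, rfl⟩
    refine mem_compression.2 ⟨B * Y * C, trivial, ?_⟩
    change P * (B * Y * C) * P = B * Y * C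
    rw [← Matrix.mul_assoc, ← Matrix.mul_assoc, hPB, Matrix.mul_assoc _ C P, hCP]
  have h1 := Submodule.finrank_mono hrange
  rw [LinearMap.finrank_range_of_inj hinj, finrank_matrix, finrank_self, Fintype.card_fin] at h1
  rw [sq]
  omega

/-- The diagonal projection onto the coordinates in a residue class modulo `3`. -/
noncomputable def residueProjection (n : ℕ) (r : Fin 3) : Matrix (Fin n) (Fin n) ℂ :=
  Matrix.diagonal fun i => if (i : ℕ) % 3 = r then 1 else 0

theorem rank_residueProjection_le (m : ℕ) (r : Fin 3) :
    (residueProjection (3 * m) r).rank ≤ m := by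
  rw [residueProjection, rank_diagonal]
  have hmod : ∀ i : {i : Fin (3 * m) // (if (i : ℕ) % 3 = r then (1 : ℂ) else 0) ≠ 0},
      ((i : Fin (3 * m)) : ℕ) % 3 = r := fun i => by simpa using i.2
  refine (Fintype.card_le_of_injective (β := Fin m) (fun i => ⟨(i.1 : ℕ) / 3, by omega⟩)
    fun i j hij => ?_).trans (Fintype.card_fin m).le
  have h1 := hmod i
  have h2 := hmod j
  have h3 : (i.1 : ℕ) / 3 = (j.1 : ℕ) / 3 := congrArg Fin.val hij
  exact Subtype.ext (Fin.ext (by omega))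

theorem sum_residueProjection (n : ℕ) : ∑ r, residueProjection n r = 1 := by
  ext i j
  rw [Matrix.sum_apply]
  rcases eq_or_ne i j with rfl | hij
  · simp only [residueProjection, diagonal_apply_eq, Matrix.one_apply_eq, Fin.sum_univ_three]
    have : (i : ℕ) % 3 = 0 ∨ (i : ℕ) % 3 = 1 ∨ (i : ℕ) % 3 = 2 := by omega
    rcases this with h | h | h <;> simp [h]
  · simp [residueProjection, hij]

theorem not_quantumRamseyProperty {m k : ℕ} (hmk : m < k) :
    ¬ QuantumRamseyProperty 2 k (3 * m) := by
  let V := Submodule.span ℂ (Set.range (residueProjection (3 * m)))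
  have hmem : ∀ r, residueProjection (3 * m) r ∈ V := fun r =>
    Submodule.subset_span (Set.mem_range_self r)
  have hV : IsOperatorSystem V := by
    refine ⟨?_, fun A hA => ?_⟩
    · rw [← sum_residueProjection]
      exact V.sum_mem fun r _ => hmem r
    · obtain ⟨c, rfl⟩ := (Submodule.mem_span_range_iff_exists_fun ℂ).1 hA
      rw [conjTranspose_sum]
      refine V.sum_mem fun r _ => ?_
      rw [conjTranspose_smul]
      refine V.smul_mem _ ?_
      have : (residueProjection (3 * m) r)ᴴ = residueProjection (3 * m) r := by
        rw [residueProjection, diagonal_conjTranspose]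
        congr 1
        ext i
        simp only [Pi.star_apply]
        split_ifs <;> simp
      rw [this]
      exact hmem r
  intro h
  rcases h V hV with h | ⟨P, hP, hPk, hPV⟩
  · have h1 := h.sq_le_finrank
    have h2 : finrank ℂ V ≤ Fintype.card (Fin 3) := finrank_range_le_card _
    rw [Fintype.card_fin] at h2
    omega
  -- Each compression is a multiple of `P` but has rank at most `m < k`, so the multiple is zero.
  -- Summing over the three residues gives `P = 0`, contradicting its rank.
  · have hzero : ∀ r, P * residueProjection (3 * m) r * P = 0 := by
      intro r
      have h1 : P * residueProjection (3 * m) r * P ∈ Submodule.span ℂ {P} :=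
        hPV ▸ mem_compression.2 ⟨_, hmem r, rfl⟩
      obtain ⟨c, hc⟩ := Submodule.mem_span_singleton.1 h1
      rcases eq_or_ne c 0 with rfl | hc0
      · rw [← hc, zero_smul]
      · have h2 : P = P * residueProjection (3 * m) r * (c⁻¹ • P) := by
          rw [Matrix.mul_smul, ← hc, smul_smul, inv_mul_cancel₀ hc0, one_smul]
        have h3 : P.rank ≤ m := by
          conv_lhs => rw [h2]
          exact (rank_mul_le_left _ _).trans ((rank_mul_le_right _ _).trans
            (rank_residueProjection_le m r))
        omega
    have hP0 : P = 0 := by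
      have h1 : P * (∑ r, residueProjection (3 * m) r) * P = P := by
        rw [sum_residueProjection, Matrix.mul_one]
        exact hP.isIdempotentElem
      rw [← h1, Matrix.mul_sum, Matrix.sum_mul]
      exact Finset.sum_eq_zero fun r _ => hzero r
    rw [hP0, rank_zero] at hPk
    omega

end LowerBound

/-! ### The value of the Ramsey number -/

theorem quantumRamseyProperty_two {k n : ℕ} (hk : 0 < k) (hn : 3 * k - 2 ≤ n) :
    QuantumRamseyProperty 2 k n := by
  intro V hV
  rcases le_or_gt (finrank ℂ V) 3 with h | h
  · exact Or.inr (hasAnticlique_of_finrank_le_three hV hk hn h)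
  · exact Or.inl (hasClique_two_of_four_le_finrank hV h)

theorem not_quantumRamseyProperty_two {k : ℕ} (hk : 0 < k) :
    ¬ QuantumRamseyProperty 2 k (3 * k - 3) := by
  have := not_quantumRamseyProperty (m := k - 1) (k := k) (by omega)
  rwa [show 3 * (k - 1) = 3 * k - 3 by omega] at this

theorem quantumRamseyNumber_two {k : ℕ} (hk : 0 < k) : quantumRamseyNumber 2 k = 3 * k - 2 := by
  refine le_antisymm (Nat.sInf_le ⟨by omega, fun n hn => quantumRamseyProperty_two hk hn⟩) ?_
  refine le_csInf ⟨3 * k - 2, by omega, fun n hn => quantumRamseyProperty_two hk hn⟩ ?_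
  rintro N ⟨-, hN⟩
  by_contra! hlt
  exact not_quantumRamseyProperty_two hk (hN _ (by omega))

theorem mainTheorem1 :
    (∀ k : ℕ, 0 < k →
      quantumRamseyNumber 2 k = 3 * k - 2 ∧
      (∀ n : ℕ, 3 * k - 2 ≤ n → QuantumRamseyProperty 2 k n) ∧
      ¬ QuantumRamseyProperty 2 k (3 * k - 3)) ∧
    quantumRamseyNumber 2 2 = 4 := by
  refine ⟨fun k hk => ⟨quantumRamseyNumber_two hk, fun n hn => quantumRamseyProperty_two hk hn,
    not_quantumRamseyProperty_two hk⟩, quantumRamseyNumber_two two_pos⟩
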